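/- **Market.** Let $r,\mu,\sigma,p>0$, $\alpha,\beta,\lambda\ge 0$, $\rho\in[-1,1]$ be constants. Let $W_1,W_2$ be standard Brownian motions and let $N(dv,dz)$ be a Poisson random measure on $[0,\infty)\times\mathbb R$ with intensity $\lambda\,dv\,dF_Z(z)$, where $F_Z$ is the distribution of a random variable $Z$ and $W_1,W_2,N,Z$ are independent ($\lambda=0$ means no jumps). Let $\mathbb F$ be the filtration they generate, augmented by the null sets. Let $\gamma:\mathbb R\to(0,\infty)$ be measurable with $\bar\gamma_1=\mathbb E[\gamma(Z)]<\infty$ and $\bar\gamma_2=\mathbb E[\gamma(Z)^2]<\infty$, and put $\bar\mu=\mu-r$, $\bar p=p-\alpha$. Assume $D:=\beta^2(1-\rho^2)+\lambda\bar\gamma_2\neq0$ and define $$\kappa_1=\frac{\bar\mu(\beta^2+\lambda\bar\gamma_2)+\rho\beta\sigma(\bar p-\lambda\bar\gamma_1)}{D\sigma^2},\qquad \kappa_2=\frac{\rho\beta\bar\mu+(\bar p-\lambda\bar\gamma_1)\sigma}{D\sigma},$$ $$\kappa_3=\frac{(\beta^2+\lambda\bar\gamma_2)\bar\mu^2+2\rho\beta\sigma\bar\mu(\bar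 p-\lambda\bar\gamma_1)+(\bar p-\lambda\bar\gamma_1)^2\sigma^2}{D\sigma^2}.$$ **Wealth.** Let $\theta>0$, $0\le t\le T$, $x\in\mathbb R$. Let $u^*=(\pi^*,L^*)$ be the deterministic strategy $$\pi^*(s)=\frac{\kappa_1}{\theta}e^{-r(T-s)},\qquad L^*(s)=\frac{\kappa_2}{\theta}e^{-r(T-s)},$$ and let $X^*$ be the wealth process under $u^*$ started from $x$ at time $t$, that is, the càdlàg $\mathbb F$-adapted process on $[t,T]$ with $X^*(t)=x$ and $$dX^*=(rX^*+\bar\mu\pi^*+\bar pL^*)\,ds+(\sigma\pi^*-\rho\beta L^*)\,dW_1-\beta\sqrt{1-\rho^2}\,L^*\,dW_2-L^*\int_{\mathbb R}\gamma(z)\,N(ds,dz).$$ Write $\mathbb E_{t,x}$ and $\mathbb V_{t,x}$ for expectation and variance under this initial condition. **Proposition.** 1. One has $\bar\mu\kappa_1+(\bar p-\lambda\bar\gamma_1)\kappa_2=(\sigma\kappa_1-\rho\beta\kappa_2)^2+\beta^2(1-\rho^2)\kappa_2^2+\lambda\bar\gamma_2\kappa_2^2=\kappa_3$, and $\kappa_3>0$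 provided that $\bar\mu\ne0$ or $\bar p\neq\lambda\bar\gamma_1$. 2. For all $t\le s\le T$, $X^*(s)$ is square integrable and $$\mathbb E_{t,x}[X^*(s)]=xe^{r(s-t)}+\frac{\kappa_3}{\theta}e^{-r(T-s)}(s-t),\qquad \mathbb V_{t,x}[X^*(s)]=\frac{\kappa_3}{\theta^2}e^{-2r(T-s)}(s-t),$$ and the mean-variance tradeoff is $$\mathbb E_{t,x}[X^*(s)]-\frac\theta2\mathbb V_{t,x}[X^*(s)]=xe^{r(s-t)}+\frac{\kappa_3}{\theta}e^{-r(T-s)}\Big(1-\frac12e^{-r(T-s)}\Big)(s-t).$$ 3. If $\bar\mu\ne0$ or $\bar p\neq\lambda\bar\gamma_1$, the dynamic efficient frontier is $$\mathbb V_{t,x}[X^*(s)]=\frac{\big(\mathbb E_{t,x}[X^*(s)]-xe^{r(s-t)}\big)^2}{\kappa_3(s-t)},\qquad t<s\le T.$$ -/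

import Mathlib

open MeasureTheory ProbabilityTheory Filter Topology
open scoped NNReal ENNReal

noncomputable section

/-- Lebesgue measure on the time axis `[0, ∞)`. -/
def timeMeasure : Measure ℝ≥0 := (volume : Measure ℝ).comap ((↑) : ℝ≥0 → ℝ)

/-- `N` is a Poisson random measure on `E` with intensity `ν`: the number of points in a measurable
set `A` is Poisson distributed with parameter `ν A` (and is a.s. infinite when `ν A = ∞`), and the
numbers of points in pairwise disjoint sets are independent. -/
structure IsPoissonRandomMeasure {Ω E : Type*} [MeasurableSpace Ω] [MeasurableSpace E]
    (N : Ω → Measure E) (ν : Measure E) (P : Measure Ω) : Prop where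
  measurable : Measurable N
  law : ∀ A : Set E, MeasurableSet A → ν A ≠ ∞ →
    HasLaw (fun ω => N ω A) ((poissonMeasure (ν A).toNNReal).map (fun k : ℕ => (k : ℝ≥0∞))) P
  top : ∀ A : Set E, MeasurableSet A → ν A = ∞ → ∀ᵐ ω ∂P, N ω A = ∞
  indep : ∀ (n : ℕ) (A : Fin n → Set E), (∀ i, MeasurableSet (A i)) →
    Pairwise (fun i j => Disjoint (A i) (A j)) → iIndepFun (fun i ω => N ω (A i)) P

/-- A simple predictable process
`v ↦ ∑ i < n, coef i * 1_{(time i, time (i + 1)]}(v)`, where `coef i` is bounded and known at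
`time i`. -/
structure SimpleIntegrand {Ω : Type*} {mΩ : MeasurableSpace Ω} (𝓕 : Filtration ℝ≥0 mΩ) where
  n : ℕ
  time : ℕ → ℝ≥0
  time_mono : Monotone time
  coef : ℕ → Ω → ℝ
  coef_measurable : ∀ i, Measurable[𝓕 (time i)] (coef i)
  coef_bounded : ∃ C : ℝ, ∀ i ω, |coef i ω| ≤ C

namespace SimpleIntegrand

variable {Ω : Type*} {mΩ : MeasurableSpace Ω} {𝓕 : Filtration ℝ≥0 mΩ}

/-- The value of a simple process at time `v`. -/
def value (V : SimpleIntegrand 𝓕) (v : ℝ≥0) (ω : Ω) : ℝ :=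
  ∑ i ∈ Finset.range V.n, (Set.Ioc (V.time i) (V.time (i + 1))).indicator (fun _ => V.coef i ω) v

/-- The elementary integral `∫_t^s V dW` (for `t ≤ s`):
the sum of `coef i` times the increment of `W` over `(time i, time (i + 1)] ∩ (t, s]`. -/
def integral (V : SimpleIntegrand 𝓕) (W : ℝ≥0 → Ω → ℝ) (t s : ℝ≥0) (ω : Ω) : ℝ :=
  ∑ i ∈ Finset.range V.n,
    V.coef i ω * (W (min (max (V.time (i + 1)) t) s) ω - W (min (max (V.time i) t) s) ω)

end SimpleIntegrand

/-- `I s = ∫_t^s H dW` for `s ∈ [t, T]`, as an Itô integral of a progressively measurable, square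
integrable process: `I` is adapted, has a.s. continuous paths, and there are simple processes `V k`
with `E ∫_t^T (V k - H)² dv → 0` such that `∫_t^s V k dW → I s` in `L²` for every `s ∈ [t, T]`. -/
structure IsItoIntegral {Ω : Type*} {mΩ : MeasurableSpace Ω} (𝓕 : Filtration ℝ≥0 mΩ)
    (P : Measure Ω) (W H : ℝ≥0 → Ω → ℝ) (t T : ℝ≥0) (I : ℝ≥0 → Ω → ℝ) : Prop where
  progressive : IsStronglyProgressive 𝓕 H
  square_integrable : ∫⁻ ω, (∫⁻ v in Set.Ioc t T, ENNReal.ofReal ((H v ω) ^ 2) ∂timeMeasure) ∂P < ∞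
  adapted : ∀ s ∈ Set.Icc t T, Measurable[𝓕 s] (I s)
  continuous : ∀ᵐ ω ∂P, ContinuousOn (fun s => I s ω) (Set.Icc t T)
  approx : ∃ V : ℕ → SimpleIntegrand 𝓕,
    Tendsto (fun k => ∫⁻ ω, (∫⁻ v in Set.Ioc t T,
      ENNReal.ofReal (((V k).value v ω - H v ω) ^ 2) ∂timeMeasure) ∂P) atTop (𝓝 0) ∧
    ∀ s ∈ Set.Icc t T, Tendsto (fun k => ∫⁻ ω,
      ENNReal.ofReal (((V k).integral W t s ω - I s ω) ^ 2) ∂P) atTop (𝓝 0)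

/-- The financial and insurance market: its constants, the claim size function `γ`, the driving
noises `W₁`, `W₂`, `N`, and the random variable `Z` whose distribution is the mark distribution of
`N`. -/
structure InsuranceMarket {Ω : Type*} [MeasurableSpace Ω] (P : Measure Ω) where
  /-- risk-free rate -/
  r : ℝ
  /-- appreciation rate of the risky asset -/
  μ : ℝ
  /-- volatility of the risky asset -/
  σ : ℝ
  /-- drift of the unit liability -/
  α : ℝ
  /-- volatility of the unit liability -/
  β : ℝ
  /-- correlation between the two markets -/
  ρ : ℝ
  /-- unit premium rate -/
  p : ℝ
  /-- jump intensity -/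
  lam : ℝ
  /-- jump size as a function of the mark -/
  γ : ℝ → ℝ
  /-- Brownian motion of the risky asset -/
  W₁ : ℝ≥0 → Ω → ℝ
  /-- second, independent Brownian motion -/
  W₂ : ℝ≥0 → Ω → ℝ
  /-- random measure of (claim time, mark) -/
  N : Ω → Measure (ℝ≥0 × ℝ)
  /-- generic mark -/
  Z : Ω → ℝ
  r_pos : 0 < r
  μ_pos : 0 < μ
  σ_pos : 0 < σ
  α_nonneg : 0 ≤ α
  β_nonneg : 0 ≤ β
  ρ_mem : ρ ∈ Set.Icc (-1 : ℝ) 1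
  p_pos : 0 < p
  lam_nonneg : 0 ≤ lam
  γ_measurable : Measurable γ
  γ_pos : ∀ z, 0 < γ z
  Z_measurable : Measurable Z
  γ_integrable : Integrable γ (P.map Z)
  γ_sq_integrable : Integrable (fun z => γ z ^ 2) (P.map Z)
  W₁_measurable : ∀ t, Measurable (W₁ t)
  W₂_measurable : ∀ t, Measurable (W₂ t)
  W₁_brownian : IsBrownianReal W₁ P
  W₂_brownian : IsBrownianReal W₂ P
  N_poisson : IsPoissonRandomMeasure N
    (ENNReal.ofReal lam • timeMeasure.prod (P.map Z)) P
  /-- `W₁`, `W₂`, `N` and `Z` are independent -/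
  indep : iIndep ![⨆ t, MeasurableSpace.comap (W₁ t) inferInstance,
    ⨆ t, MeasurableSpace.comap (W₂ t) inferInstance,
    MeasurableSpace.comap N inferInstance, MeasurableSpace.comap Z inferInstance] P
  /-- standing non-degeneracy assumption; automatic when `lam > 0` -/
  nondegenerate : β ^ 2 * (1 - ρ ^ 2) + lam * ∫ z, γ z ^ 2 ∂(P.map Z) ≠ 0

namespace InsuranceMarket

variable {Ω : Type*} [mΩ : MeasurableSpace Ω] {P : Measure Ω} (M : InsuranceMarket P)

/-- `E[γ(Z)]` -/
def γ₁ : ℝ := ∫ z, M.γ z ∂(P.map M.Z)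

/-- `E[γ(Z)²]` -/
def γ₂ : ℝ := ∫ z, M.γ z ^ 2 ∂(P.map M.Z)

def μbar : ℝ := M.μ - M.r

def pbar : ℝ := M.p - M.α

def κ₁ : ℝ :=
  (M.μbar * (M.β ^ 2 + M.lam * M.γ₂) + M.ρ * M.β * M.σ * (M.pbar - M.lam * M.γ₁)) /
    ((M.β ^ 2 * (1 - M.ρ ^ 2) + M.lam * M.γ₂) * M.σ ^ 2)

def κ₂ : ℝ :=
  (M.ρ * M.β * M.μbar + (M.pbar - M.lam * M.γ₁) * M.σ) /
    ((M.β ^ 2 * (1 - M.ρ ^ 2) + M.lam * M.γ₂) * M.σ)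

def κ₃ : ℝ :=
  ((M.β ^ 2 + M.lam * M.γ₂) * M.μbar ^ 2
      + 2 * M.ρ * M.β * M.σ * M.μbar * (M.pbar - M.lam * M.γ₁)
      + (M.pbar - M.lam * M.γ₁) ^ 2 * M.σ ^ 2) /
    ((M.β ^ 2 * (1 - M.ρ ^ 2) + M.lam * M.γ₂) * M.σ ^ 2)

/-- The filtration generated by `W₁`, `W₂`, `N` (observed on `[0, t] × ℝ`) and `Z`, augmented with
the `P`-null sets. -/
def filtration : Filtration ℝ≥0 mΩ where
  seq t :=
    (⨆ s ∈ Set.Iic t, MeasurableSpace.comap (M.W₁ s) inferInstance) ⊔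
    (⨆ s ∈ Set.Iic t, MeasurableSpace.comap (M.W₂ s) inferInstance) ⊔
    (⨆ s ∈ Set.Iic t,
      MeasurableSpace.comap (fun ω => (M.N ω).restrict (Set.Iic s ×ˢ Set.univ)) inferInstance) ⊔
    MeasurableSpace.comap M.Z inferInstance ⊔
    MeasurableSpace.generateFrom {A | MeasurableSet A ∧ P A = 0}
  mono' := by
    intro a b hab
    have h : Set.Iic a ⊆ Set.Iic b := Set.Iic_subset_Iic.2 hab
    exact sup_le_sup_right (sup_le_sup_right (sup_le_sup (sup_le_sup (biSup_mono h)
      (biSup_mono h)) (biSup_mono h)) _) _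
  le' := by
    intro t
    refine sup_le (sup_le (sup_le (sup_le ?_ ?_) ?_) M.Z_measurable.comap_le) ?_
    · exact iSup₂_le fun s _ => (M.W₁_measurable s).comap_le
    · exact iSup₂_le fun s _ => (M.W₂_measurable s).comap_le
    · refine iSup₂_le fun s _ => Measurable.comap_le ?_
      refine Measure.measurable_of_measurable_coe _ fun A hA => ?_
      simp only [Measure.restrict_apply hA]
      exact (Measure.measurable_coe (hA.inter (measurableSet_Iic.prod MeasurableSet.univ))).comp
        M.N_poisson.measurable
    · exact MeasurableSpace.generateFrom_le fun A hA => hA.1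

/-- `X` is the wealth process on `[t, T]`, started from `x` at time `t`, of an insurer who holds the
amount `π` in the risky asset and the amount `L` of liabilities: a càdlàg adapted process with
`X t = x` that solves
`dX = (r X + μbar π + pbar L) dv + (σ π - ρ β L) dW₁ - β √(1 - ρ²) L dW₂ - L ∫ γ(z) N(dv, dz)`.
The stochastic integrals are Itô integrals, the jump integral is a pathwise integral with respect
to the measure `N ω`. -/
structure IsWealthPath (π L : ℝ≥0 → Ω → ℝ) (t T : ℝ≥0) (x : ℝ) (X : ℝ≥0 → Ω → ℝ) : Prop where
  adapted : ∀ s ∈ Set.Icc t T, Measurable[M.filtration s] (X s)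
  rightCont : ∀ᵐ ω ∂P, ∀ s ∈ Set.Icc t T,
    ContinuousWithinAt (fun v => X v ω) (Set.Icc s T) s
  leftLim : ∀ᵐ ω ∂P, ∀ s ∈ Set.Icc t T,
    ∃ l : ℝ, Tendsto (fun v => X v ω) (𝓝[Set.Ico t s] s) (𝓝 l)
  initial : ∀ᵐ ω ∂P, X t ω = x
  sde : ∃ I₁ I₂ : ℝ≥0 → Ω → ℝ,
    IsItoIntegral M.filtration P M.W₁ (fun v ω => M.σ * π v ω - M.ρ * M.β * L v ω) t T I₁ ∧
    IsItoIntegral M.filtration P M.W₂ (fun v ω => M.β * √(1 - M.ρ ^ 2) * L v ω) t T I₂ ∧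
    ∀ᵐ ω ∂P, ∀ s ∈ Set.Icc t T,
      X s ω = x + (∫ v in Set.Ioc t s, (M.r * X v ω + M.μbar * π v ω + M.pbar * L v ω)
          ∂timeMeasure)
        + I₁ s ω - I₂ s ω
        - ∫ q in Set.Ioc t s ×ˢ Set.univ, L q.1 ω * M.γ q.2 ∂(M.N ω)

/-- Optimal investment strategy for horizon `T` and risk aversion `θ` (deterministic). -/
def optInvestment (θ : ℝ) (T : ℝ≥0) : ℝ≥0 → Ω → ℝ :=
  fun s _ => M.κ₁ / θ * Real.exp (-M.r * ((T : ℝ) - s))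

/-- Optimal liability strategy for horizon `T` and risk aversion `θ` (deterministic). -/
def optLiability (θ : ℝ) (T : ℝ≥0) : ℝ≥0 → Ω → ℝ :=
  fun s _ => M.κ₂ / θ * Real.exp (-M.r * ((T : ℝ) - s))

end InsuranceMarket

end

/-! Write `ψ(u) = exp(-r(T-u))`. Both components of the strategy are constants times `ψ`, and `ψ' =
rψ`. Wealth earned at time `v` grows by `exp(r(s-v))` until `s`, and `exp(r(s-v)) ψ(v) = ψ(s)`.
Every contribution thus carries the same factor `ψ(s)`, and almost surely, for all `s`, `X(s) = x
exp(r(s-t)) + K ψ(s)(s-t) + ψ(s) S(s)`. Here `K = (μbar κ₁ + pbar κ₂)/θ`, and `S` (`noise`) is a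
linear combination of the increments of `W₁` and `W₂` and of the total claims on `(t,s]`. This is
`IsWealthPath.ae_eq`.

The closed form is proved path by path. For a deterministic smooth integrand the Itô integral equals
the integration-by-parts expression `wienerIntegral` (`IsItoIntegral.ae_forall_eq_wienerIntegral`):
by an isometry, the simple approximants converge in `L²` to both. The jump integral is integrated by
parts through Fubini. What remains is a linear integral equation with a given forcing, whose
solution is unique (`eq_of_eq_add_integral`).

For the moments, Brownian increments are centred with variance `s - t`, Campbell's formulas give the
claims mean `λ(s-t)γ₁` and variance `λ(s-t)γ₂`, and independence removes the covariances. The claims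
mean changes `pbar` into `pbar - λγ₁`; both the drift rate and the variance rate then reduce to `κ₃`
by algebra, and the frontier follows by eliminating `θ`. -/

/-! ### Poisson moments and Campbell's formulas. -/

/-- The Stein–Chen identity for the Poisson distribution. -/
theorem lintegral_mul_poissonMeasure (a : ℝ≥0) (f : ℕ → ℝ≥0∞) :
    ∫⁻ k, (k : ℝ≥0∞) * f k ∂(poissonMeasure a) = a * ∫⁻ k, f (k + 1) ∂(poissonMeasure a) := by
  rw [lintegral_countable', lintegral_countable', tsum_eq_zero_add' ENNReal.summable,
    ← ENNReal.tsum_mul_left]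
  simp only [poissonMeasure_singleton, Nat.cast_zero, zero_mul, zero_add]
  refine tsum_congr fun k => ?_
  have h : ((k + 1 : ℕ) : ℝ≥0∞) * ENNReal.ofReal (Real.exp (-a) * a ^ (k + 1) / (k + 1).factorial)
      = a * ENNReal.ofReal (Real.exp (-a) * a ^ k / k.factorial) := by
    rw [← ENNReal.ofReal_natCast, ← ENNReal.ofReal_coe_nnreal,
      ← ENNReal.ofReal_mul (by positivity), ← ENNReal.ofReal_mul (by positivity)]
    congr 1
    rw [Nat.factorial_succ]
    push_cast
    field_simp
    ring
  calc _ = (((k + 1 : ℕ) : ℝ≥0∞) *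
        ENNReal.ofReal (Real.exp (-a) * a ^ (k + 1) / (k + 1).factorial)) * f (k + 1) := by ring
    _ = _ := by rw [h]; ring

theorem lintegral_id_poissonMeasure (a : ℝ≥0) :
    ∫⁻ k, (k : ℝ≥0∞) ∂(poissonMeasure a) = a := by
  simpa using lintegral_mul_poissonMeasure a 1

theorem lintegral_sq_poissonMeasure (a : ℝ≥0) :
    ∫⁻ k, (k : ℝ≥0∞) ^ 2 ∂(poissonMeasure a) = a + a ^ 2 := by
  have h := lintegral_mul_poissonMeasure a (fun k => (k : ℝ≥0∞))
  simp only [Nat.cast_add, Nat.cast_one, ← pow_two] at h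
  rw [h, lintegral_add_right _ measurable_const, lintegral_id_poissonMeasure]
  simp
  ring

namespace IsPoissonRandomMeasure

variable {Ω E : Type*} [MeasurableSpace Ω] [MeasurableSpace E] {N : Ω → Measure E} {ν : Measure E}
  {P : Measure Ω}

theorem measurable_apply (hN : IsPoissonRandomMeasure N ν P) {A : Set E} (hA : MeasurableSet A) :
    Measurable fun ω => N ω A :=
  (Measure.measurable_coe hA).comp hN.measurable

/-- Campbell's formulas below assume a finite intensity; restriction to a bounded time window
provides it. -/
theorem restrict (hN : IsPoissonRandomMeasure N ν P) {C : Set E} (hC : MeasurableSet C) :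
    IsPoissonRandomMeasure (fun ω => (N ω).restrict C) (ν.restrict C) P where
  measurable := by
    refine Measure.measurable_of_measurable_coe _ fun A hA => ?_
    simp only [Measure.restrict_apply hA]
    exact hN.measurable_apply (hA.inter hC)
  law A hA h := by
    simp only [Measure.restrict_apply hA] at h ⊢
    exact hN.law _ (hA.inter hC) h
  top A hA h := by
    simp only [Measure.restrict_apply hA] at h ⊢
    exact hN.top _ (hA.inter hC) h
  indep n A hA hd := by
    simp only [Measure.restrict_apply (hA _)]
    exact hN.indep n _ (fun i => (hA i).inter hC) fun i j hij =>
      (hd hij).mono Set.inter_subset_left Set.inter_subset_left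

theorem lintegral_comp_apply (hN : IsPoissonRandomMeasure N ν P) {A : Set E}
    (hA : MeasurableSet A) (h : ν A ≠ ∞) {f : ℝ≥0∞ → ℝ≥0∞} (hf : Measurable f) :
    ∫⁻ ω, f (N ω A) ∂P = ∫⁻ k, f (k : ℕ) ∂(poissonMeasure (ν A).toNNReal) := by
  have := (hN.law A hA h).map_eq
  rw [← lintegral_map hf (hN.measurable_apply hA), this, lintegral_map hf (by fun_prop)]

theorem lintegral_apply (hN : IsPoissonRandomMeasure N ν P) {A : Set E} (hA : MeasurableSet A)
    (h : ν A ≠ ∞) : ∫⁻ ω, N ω A ∂P = ν A := by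
  rw [hN.lintegral_comp_apply hA h (f := fun y => y) measurable_id]
  simp [lintegral_id_poissonMeasure, h]

theorem lintegral_apply_sq (hN : IsPoissonRandomMeasure N ν P) {A : Set E} (hA : MeasurableSet A)
    (h : ν A ≠ ∞) : ∫⁻ ω, N ω A ^ 2 ∂P = ν A + ν A ^ 2 := by
  rw [hN.lintegral_comp_apply hA h (f := fun y => y ^ 2) (by fun_prop),
    lintegral_sq_poissonMeasure, ENNReal.coe_toNNReal h]

theorem lintegral_apply_mul_apply (hN : IsPoissonRandomMeasure N ν P) {A B : Set E}
    (hA : MeasurableSet A) (hB : MeasurableSet B) (hAB : Disjoint A B) (h : ν A ≠ ∞)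
    (h' : ν B ≠ ∞) : ∫⁻ ω, N ω A * N ω B ∂P = ν A * ν B := by
  have hi := hN.indep 2 ![A, B] (by intro i; fin_cases i <;> simpa)
    (by intro i j hij; fin_cases i <;> fin_cases j <;> simp_all [hAB.symm])
  have hi' : IndepFun (fun ω => N ω A) (fun ω => N ω B) P := by
    simpa using hi.indepFun (show (0 : Fin 2) ≠ 1 by simp)
  have := lintegral_mul_eq_lintegral_mul_lintegral_of_indepFun (hN.measurable_apply hA)
    (hN.measurable_apply hB) hi'
  simp only [Pi.mul_apply] at this
  rw [this, hN.lintegral_apply hA h, hN.lintegral_apply hB h']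

/-- **Campbell's formula** for the mean of an integral against a Poisson random measure. -/
theorem lintegral_lintegral [IsFiniteMeasure ν] (hN : IsPoissonRandomMeasure N ν P) {f : E → ℝ≥0∞}
    (hf : Measurable f) : ∫⁻ ω, ∫⁻ e, f e ∂(N ω) ∂P = ∫⁻ e, f e ∂ν := by
  have : P.bind N = ν := by
    ext A hA
    rw [Measure.bind_apply hA hN.measurable.aemeasurable, hN.lintegral_apply hA (measure_ne_top _ _)]
  rw [← Measure.lintegral_bind hN.measurable.aemeasurable hf.aemeasurable, this]

theorem lintegral_sq_simpleFunc [IsFiniteMeasure ν] (hN : IsPoissonRandomMeasure N ν P)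
    (g : SimpleFunc E ℝ≥0∞) :
    ∫⁻ ω, (∫⁻ e, g e ∂(N ω)) ^ 2 ∂P = ∫⁻ e, g e ^ 2 ∂ν + (∫⁻ e, g e ∂ν) ^ 2 := by
  have h2 : ∫⁻ e, g e ^ 2 ∂ν = ∑ y ∈ g.range, y ^ 2 * ν (g ⁻¹' {y}) := by
    rw [← SimpleFunc.map_lintegral, ← SimpleFunc.lintegral_eq_lintegral]
    simp
  have hm : ∀ y, Measurable fun ω => N ω (g ⁻¹' {y}) := fun y =>
    hN.measurable_apply (g.measurableSet_preimage _)
  -- Distinct level sets of `g` are disjoint, so their counts are independent and only the diagonal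
  -- contributes beyond the product of means.
  have hyz : ∀ y z, ∫⁻ ω, (y * N ω (g ⁻¹' {y})) * (z * N ω (g ⁻¹' {z})) ∂P
      = (if y = z then y ^ 2 * ν (g ⁻¹' {y}) else 0)
        + (y * ν (g ⁻¹' {y})) * (z * ν (g ⁻¹' {z})) := by
    intro y z
    have e : ∀ ω, (y * N ω (g ⁻¹' {y})) * (z * N ω (g ⁻¹' {z}))
        = (y * z) * (N ω (g ⁻¹' {y}) * N ω (g ⁻¹' {z})) := fun ω => by ring
    have hmm : Measurable fun ω => N ω (g ⁻¹' {y}) * N ω (g ⁻¹' {z}) := (hm y).mul (hm z)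
    simp_rw [e]
    rw [lintegral_const_mul _ hmm]
    split_ifs with h
    · subst h
      simp_rw [← pow_two]
      rw [hN.lintegral_apply_sq (g.measurableSet_preimage _) (measure_ne_top _ _)]
      ring
    · rw [hN.lintegral_apply_mul_apply (g.measurableSet_preimage _) (g.measurableSet_preimage _)
        ((Set.disjoint_singleton.2 h).preimage g) (measure_ne_top _ _) (measure_ne_top _ _)]
      ring
  simp_rw [h2, SimpleFunc.lintegral_eq_lintegral, SimpleFunc.lintegral, pow_two (Finset.sum _ _),
    Finset.sum_mul_sum]
  have hmm : ∀ y z, Measurable fun ω => (y * N ω (g ⁻¹' {y})) * (z * N ω (g ⁻¹' {z})) :=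
    fun y z => ((hm y).const_mul y).mul ((hm z).const_mul z)
  rw [lintegral_finsetSum _ fun y _ => Finset.measurable_fun_sum _ fun z _ => hmm y z]
  rw [← Finset.sum_add_distrib]
  refine Finset.sum_congr rfl fun y hy => ?_
  rw [lintegral_finsetSum _ fun z _ => hmm y z]
  simp_rw [hyz, Finset.sum_add_distrib]
  rw [Finset.sum_ite_eq, if_pos hy]

/-- **Campbell's formula** for the second moment of an integral against a Poisson random
measure. -/
theorem lintegral_lintegral_sq [IsFiniteMeasure ν] (hN : IsPoissonRandomMeasure N ν P)
    {f : E → ℝ≥0∞} (hf : Measurable f) :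
    ∫⁻ ω, (∫⁻ e, f e ∂(N ω)) ^ 2 ∂P = ∫⁻ e, f e ^ 2 ∂ν + (∫⁻ e, f e ∂ν) ^ 2 := by
  -- All terms are increasing in `f`, so monotone convergence carries the formula over from simple
  -- functions.
  have hmono := SimpleFunc.monotone_eapprox f
  have hlim : ∀ e, Tendsto (fun n => SimpleFunc.eapprox f n e) atTop (𝓝 (f e)) := fun e =>
    SimpleFunc.tendsto_eapprox hf e
  have hsq : Monotone fun y : ℝ≥0∞ => y ^ 2 := fun a b hab => pow_le_pow_left' hab 2
  have key : ∀ κ : Measure E, Tendsto (fun n => ∫⁻ e, SimpleFunc.eapprox f n e ∂κ) atTop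
      (𝓝 (∫⁻ e, f e ∂κ)) := fun κ =>
    lintegral_tendsto_of_tendsto_of_monotone (fun n => (SimpleFunc.measurable _).aemeasurable)
      (ae_of_all _ fun e n m h => hmono h e) (ae_of_all _ hlim)
  have h1 : Tendsto (fun n => ∫⁻ ω, (∫⁻ e, SimpleFunc.eapprox f n e ∂(N ω)) ^ 2 ∂P) atTop
      (𝓝 (∫⁻ ω, (∫⁻ e, f e ∂(N ω)) ^ 2 ∂P)) :=
    lintegral_tendsto_of_tendsto_of_monotone
      (fun n => (((Measure.measurable_lintegral (SimpleFunc.measurable _)).comp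
        hN.measurable).pow_const 2).aemeasurable)
      (ae_of_all _ fun ω n m h => hsq (lintegral_mono (hmono h)))
      (ae_of_all _ fun ω => ((ENNReal.continuous_pow 2).tendsto _).comp (key (N ω)))
  have h2 : Tendsto (fun n => ∫⁻ e, SimpleFunc.eapprox f n e ^ 2 ∂ν) atTop
      (𝓝 (∫⁻ e, f e ^ 2 ∂ν)) :=
    lintegral_tendsto_of_tendsto_of_monotone
      (fun n => ((SimpleFunc.measurable _).pow_const 2).aemeasurable)
      (ae_of_all _ fun e n m h => hsq (hmono h e))
      (ae_of_all _ fun e => ((ENNReal.continuous_pow 2).tendsto _).comp (hlim e))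
  have h3 := ((ENNReal.continuous_pow 2).tendsto _).comp (key ν)
  refine tendsto_nhds_unique h1 ?_
  simp_rw [hN.lintegral_sq_simpleFunc]
  exact h2.add h3

end IsPoissonRandomMeasure

/-! ### Independence of Brownian increments from the market filtration. -/

/-- On the π-system of sets `a ∩ b`, `P(a ∩ b ∩ c) = P(a ∩ c) P(b) = P(a) P(b) P(c)`. The
application has `m` generated by one Brownian motion, `A` its past, `C` its future increments, and
`B` the other noises. -/
theorem indep_sup_left_of_le {Ω : Type*} {A B C m mΩ : MeasurableSpace Ω} {P : Measure Ω}
    [IsProbabilityMeasure P] (hm : m ≤ mΩ) (hB : B ≤ mΩ) (hAm : A ≤ m) (hCm : C ≤ m)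
    (hmB : Indep m B P) (hAC : Indep A C P) : Indep (A ⊔ B) C P := by
  let p : Set (Set Ω) := {s | ∃ a b, MeasurableSet[A] a ∧ MeasurableSet[B] b ∧ s = a ∩ b}
  have hp : A ⊔ B = MeasurableSpace.generateFrom p := by
    refine le_antisymm (sup_le (fun a ha => ?_) fun b hb => ?_) ?_
    · exact MeasurableSpace.measurableSet_generateFrom
        ⟨a, Set.univ, ha, MeasurableSet.univ, (Set.inter_univ a).symm⟩
    · exact MeasurableSpace.measurableSet_generateFrom
        ⟨Set.univ, b, MeasurableSet.univ, hb, (Set.univ_inter b).symm⟩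
    · refine MeasurableSpace.generateFrom_le ?_
      rintro s ⟨a, b, ha, hb, rfl⟩
      exact MeasurableSet.inter (le_sup_left (b := B) a ha) (le_sup_right (a := A) b hb)
  have hpi : IsPiSystem p := by
    rintro s ⟨a, b, ha, hb, rfl⟩ s' ⟨a', b', ha', hb', rfl⟩ -
    exact ⟨a ∩ a', b ∩ b', ha.inter ha', hb.inter hb', Set.inter_inter_inter_comm a b a' b'⟩
  refine IndepSets.indep (sup_le (hAm.trans hm) hB) (hCm.trans hm) hpi
    (@MeasurableSpace.isPiSystem_measurableSet Ω C) hp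
    (@MeasurableSpace.generateFrom_measurableSet Ω C).symm ?_
  rw [IndepSets_iff]
  rintro _ c ⟨a, b, ha, hb, rfl⟩ hc
  rw [Indep_iff] at hmB hAC
  rw [Set.inter_right_comm, hmB _ _ (MeasurableSet.inter (hAm a ha) (hCm c hc)) hb,
    hAC _ _ ha hc, hmB _ _ (hAm a ha) hb]
  ring

theorem ProbabilityTheory.Indep.eventuallyMeasurableSpace_left {Ω : Type*}
    {A C mΩ : MeasurableSpace Ω} {P : Measure Ω} (h : Indep A C P) :
    Indep (eventuallyMeasurableSpace A (ae P)) C P := by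
  rw [Indep_iff] at h ⊢
  rintro s c ⟨a, ha, hsa⟩ hc
  rw [measure_congr hsa, measure_congr (hsa.inter (EventuallyEq.refl _ c)), h a c ha hc]

/-- `W` is a Brownian motion with respect to the filtration `𝓕`. -/
structure IsBrownianFor {Ω : Type*} {mΩ : MeasurableSpace Ω} (𝓕 : Filtration ℝ≥0 mΩ)
    (W : ℝ≥0 → Ω → ℝ) (P : Measure Ω) : Prop extends IsBrownianReal W P where
  adapted : ∀ t, Measurable[𝓕 t] (W t)
  indep_shift : ∀ a, Indep (𝓕 a)
    (MeasurableSpace.comap (fun ω (v : ℝ≥0) => W (a + v) ω - W a ω) inferInstance) P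

/-- Enlarging the natural filtration by independent information `B` and by null sets leaves future
increments independent of the past. -/
theorem ProbabilityTheory.IsBrownianReal.isBrownianFor {Ω : Type*} {mΩ : MeasurableSpace Ω}
    {P : Measure Ω} [IsProbabilityMeasure P] {W : ℝ≥0 → Ω → ℝ} (hW : IsBrownianReal W P)
    (hm : ∀ t, Measurable (W t)) {B : MeasurableSpace Ω} (hB : B ≤ mΩ)
    (hWB : Indep (⨆ t, MeasurableSpace.comap (W t) inferInstance) B P) {𝓕 : Filtration ℝ≥0 mΩ}
    (had : ∀ t, Measurable[𝓕 t] (W t))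
    (hF : ∀ a, 𝓕 a ≤ eventuallyMeasurableSpace
      ((⨆ s ∈ Set.Iic a, MeasurableSpace.comap (W s) inferInstance) ⊔ B) (ae P)) :
    IsBrownianFor 𝓕 W P where
  toIsBrownianReal := hW
  adapted := had
  indep_shift a := by
    refine indep_of_indep_of_le_left (Indep.eventuallyMeasurableSpace_left ?_) (hF a)
    have hle : ∀ t, MeasurableSpace.comap (W t) inferInstance ≤
        ⨆ t, MeasurableSpace.comap (W t) inferInstance := fun t =>
      le_iSup (fun t => MeasurableSpace.comap (W t) inferInstance) t
    have hWm : ∀ t, Measurable[⨆ t, MeasurableSpace.comap (W t) inferInstance] (W t) := fun t =>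
      (comap_measurable (W t)).mono (hle t) le_rfl
    refine indep_sup_left_of_le (iSup_le fun t => (hm t).comap_le) hB
      (iSup₂_le fun s _ => hle s) ?_ hWB ?_
    · refine Measurable.comap_le ?_
      exact @measurable_pi_lambda _ _ _ (_) _ _ fun v => (hWm _).sub (hWm _)
    · have h := ((IndepFun_iff_Indep _ _ _).1 (hW.indepFun_shift a)).symm
      refine indep_of_indep_of_le_left h (iSup₂_le fun s hs => ?_)
      refine Measurable.comap_le ?_
      exact (measurable_pi_apply (⟨s, hs⟩ : Set.Iic a)).comp
        (comap_measurable (fun ω (t : Set.Iic a) => W t ω))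

namespace InsuranceMarket

variable {Ω : Type*} [mΩ : MeasurableSpace Ω] {P : Measure Ω} (M : InsuranceMarket P)

theorem comap_N_restrict_le (s : ℝ≥0) :
    MeasurableSpace.comap (fun ω => (M.N ω).restrict (Set.Iic s ×ˢ Set.univ)) inferInstance
      ≤ MeasurableSpace.comap M.N inferInstance := by
  refine Measurable.comap_le ?_
  refine Measure.measurable_of_measurable_coe _ fun A hA => ?_
  simp only [Measure.restrict_apply hA]
  exact (Measure.measurable_coe (hA.inter (measurableSet_Iic.prod MeasurableSet.univ))).comp
    (comap_measurable M.N)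

theorem noise_le (i : Fin 4) : (![⨆ t, MeasurableSpace.comap (M.W₁ t) inferInstance,
    ⨆ t, MeasurableSpace.comap (M.W₂ t) inferInstance,
    MeasurableSpace.comap M.N inferInstance,
    MeasurableSpace.comap M.Z inferInstance] : Fin 4 → MeasurableSpace Ω) i ≤ mΩ := by
  fin_cases i
  · exact iSup_le fun t => (M.W₁_measurable t).comap_le
  · exact iSup_le fun t => (M.W₂_measurable t).comap_le
  · exact M.N_poisson.measurable.comap_le
  · exact M.Z_measurable.comap_le

theorem null_le_eventuallyMeasurableSpace (m : MeasurableSpace Ω) :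
    MeasurableSpace.generateFrom {A | MeasurableSet[mΩ] A ∧ P A = 0}
      ≤ eventuallyMeasurableSpace m (ae P) :=
  MeasurableSpace.generateFrom_le fun _ hA =>
    ⟨∅, MeasurableSet.empty, ae_eq_empty.2 hA.2⟩

theorem W₁_isBrownianFor [IsProbabilityMeasure P] : IsBrownianFor M.filtration M.W₁ P := by
  have hind := indep_iSup_of_disjoint M.noise_le M.indep (S := {0}) (T := {1, 2, 3}) (by simp)
  refine M.W₁_brownian.isBrownianFor M.W₁_measurable
    (B := (⨆ t, MeasurableSpace.comap (M.W₂ t) inferInstance) ⊔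
      MeasurableSpace.comap M.N inferInstance ⊔ MeasurableSpace.comap M.Z inferInstance)
    ?_ ?_ (fun t => ?_) fun a => ?_
  · exact sup_le (sup_le (M.noise_le 1) (M.noise_le 2)) (M.noise_le 3)
  · simpa [iSup_or, iSup_sup_eq, iSup_iSup_eq_left, sup_assoc] using hind
  · refine (comap_measurable (M.W₁ t)).mono ?_ le_rfl
    refine le_trans ?_ (le_sup_of_le_left (le_sup_of_le_left (le_sup_of_le_left le_sup_left)))
    exact le_iSup₂ (f := fun s (_ : s ∈ Set.Iic t) => MeasurableSpace.comap (M.W₁ s) inferInstance)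
      t (Set.mem_Iic.2 le_rfl)
  · refine sup_le (le_trans ?_ le_eventuallyMeasurableSpace) (null_le_eventuallyMeasurableSpace _)
    refine sup_le (sup_le (sup_le le_sup_left ?_) ?_) ?_
    · exact le_sup_of_le_right (le_sup_of_le_left (le_sup_of_le_left
        (iSup₂_le fun s _ => le_iSup (fun t => MeasurableSpace.comap (M.W₂ t) inferInstance) s)))
    · exact le_sup_of_le_right (le_sup_of_le_left (le_sup_of_le_right
        (iSup₂_le fun s _ => M.comap_N_restrict_le s)))
    · exact le_sup_of_le_right le_sup_right

theorem W₂_isBrownianFor [IsProbabilityMeasure P] : IsBrownianFor M.filtration M.W₂ P := by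
  have hind := indep_iSup_of_disjoint M.noise_le M.indep (S := {1}) (T := {0, 2, 3}) (by simp)
  refine M.W₂_brownian.isBrownianFor M.W₂_measurable
    (B := (⨆ t, MeasurableSpace.comap (M.W₁ t) inferInstance) ⊔
      MeasurableSpace.comap M.N inferInstance ⊔ MeasurableSpace.comap M.Z inferInstance)
    ?_ ?_ (fun t => ?_) fun a => ?_
  · exact sup_le (sup_le (M.noise_le 0) (M.noise_le 2)) (M.noise_le 3)
  · simpa [iSup_or, iSup_sup_eq, iSup_iSup_eq_left, sup_assoc] using hind
  · refine (comap_measurable (M.W₂ t)).mono ?_ le_rfl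
    refine le_trans ?_ (le_sup_of_le_left (le_sup_of_le_left (le_sup_of_le_left le_sup_right)))
    exact le_iSup₂ (f := fun s (_ : s ∈ Set.Iic t) => MeasurableSpace.comap (M.W₂ s) inferInstance)
      t (Set.mem_Iic.2 le_rfl)
  · refine sup_le (le_trans ?_ le_eventuallyMeasurableSpace) (null_le_eventuallyMeasurableSpace _)
    refine sup_le (sup_le (sup_le ?_ le_sup_left) ?_) ?_
    · exact le_sup_of_le_right (le_sup_of_le_left (le_sup_of_le_left
        (iSup₂_le fun s _ => le_iSup (fun t => MeasurableSpace.comap (M.W₁ t) inferInstance) s)))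
    · exact le_sup_of_le_right (le_sup_of_le_left (le_sup_of_le_right
        (iSup₂_le fun s _ => M.comap_N_restrict_le s)))
    · exact le_sup_of_le_right le_sup_right

end InsuranceMarket

/-! ### Transfer between `timeMeasure` and Lebesgue measure on `ℝ`. -/

theorem measurableEmbedding_nnreal_coe : MeasurableEmbedding ((↑) : ℝ≥0 → ℝ) :=
  MeasurableEmbedding.subtype_coe measurableSet_Ici

theorem map_coe_timeMeasure_restrict (a b : ℝ≥0) :
    (timeMeasure.restrict (Set.Ioc a b)).map ((↑) : ℝ≥0 → ℝ)
      = volume.restrict (Set.Ioc (a : ℝ) b) := by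
  have h : Set.Ioc a b = ((↑) : ℝ≥0 → ℝ) ⁻¹' Set.Ioc (a : ℝ) b := rfl
  rw [h, ← measurableEmbedding_nnreal_coe.restrict_map, timeMeasure,
    measurableEmbedding_nnreal_coe.map_comap, Measure.restrict_restrict measurableSet_Ioc,
    Set.inter_eq_left.2]
  rintro x hx
  exact ⟨⟨x, a.2.trans hx.1.le⟩, rfl⟩

theorem setIntegral_timeMeasure (F : ℝ → ℝ) {a b : ℝ≥0} (hab : a ≤ b) :
    ∫ v in Set.Ioc a b, F v ∂timeMeasure = ∫ u in (a : ℝ)..b, F u := by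
  rw [intervalIntegral.integral_of_le (by exact_mod_cast hab), ← map_coe_timeMeasure_restrict,
    measurableEmbedding_nnreal_coe.integral_map]

theorem integrableOn_timeMeasure {F : ℝ → ℝ} {a b : ℝ≥0}
    (hF : IntegrableOn F (Set.Ioc (a : ℝ) b)) :
    IntegrableOn (fun v : ℝ≥0 => F v) (Set.Ioc a b) timeMeasure := by
  rw [IntegrableOn, ← map_coe_timeMeasure_restrict,
    measurableEmbedding_nnreal_coe.integrable_map_iff] at hF
  exact hF

theorem timeMeasure_Ioc (a b : ℝ≥0) : timeMeasure (Set.Ioc a b) = ENNReal.ofReal (b - a) := by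
  rw [timeMeasure, measurableEmbedding_nnreal_coe.comap_apply, NNReal.image_coe_Ioc,
    Real.volume_Ioc]

/-! ### Moments of Brownian increments weighted by past information. -/

namespace IsBrownianFor

variable {Ω : Type*} {mΩ : MeasurableSpace Ω} {𝓕 : Filtration ℝ≥0 mΩ} {W : ℝ≥0 → Ω → ℝ}
  {P : Measure Ω}

theorem memLp (hW : IsBrownianFor 𝓕 W P) (v : ℝ≥0) : MemLp (W v) 2 P :=
  (hW.isGaussianProcess.hasGaussianLaw_eval v).memLp_two

theorem memLp_sub (hW : IsBrownianFor 𝓕 W P) (u v : ℝ≥0) : MemLp (fun ω => W u ω - W v ω) 2 P :=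
  (hW.memLp u).sub (hW.memLp v)

theorem integral_sub_eq_zero (hW : IsBrownianFor 𝓕 W P) (u v : ℝ≥0) :
    ∫ ω, (W u ω - W v ω) ∂P = 0 := by
  have h := integral_sub (hW.integrable_eval u) (hW.integrable_eval v)
  rw [h, hW.integral_eval, hW.integral_eval, sub_zero]

theorem indepFun_comp_shift (hW : IsBrownianFor 𝓕 W P) {a : ℝ≥0} {Q : Ω → ℝ}
    (hQ : Measurable[𝓕 a] Q) {φ : (ℝ≥0 → ℝ) → ℝ} (hφ : Measurable φ) :
    IndepFun Q (fun ω => φ fun v => W (a + v) ω - W a ω) P := by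
  rw [IndepFun_iff_Indep]
  refine indep_of_indep_of_le (hW.indep_shift a) hQ.comap_le ?_
  exact (hφ.comp (comap_measurable _)).comap_le

theorem memLp_mul_increment (hW : IsBrownianFor 𝓕 W P) {a b : ℝ≥0} {c : Ω → ℝ}
    (hc : Measurable c) {C : ℝ} (hC : ∀ ω, |c ω| ≤ C) :
    MemLp (fun ω => c ω * (W b ω - W a ω)) 2 P :=
  (hW.memLp_sub b a).mul' (memLp_top_of_bound hc.aestronglyMeasurable C (ae_of_all _ hC))

theorem integral_mul_increment (hW : IsBrownianFor 𝓕 W P) {a b : ℝ≥0} (hab : a ≤ b) {Q : Ω → ℝ}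
    (hQ : Measurable[𝓕 a] Q) : ∫ ω, Q ω * (W b ω - W a ω) ∂P = 0 := by
  have hi := hW.indepFun_comp_shift hQ (φ := fun f => f (b - a)) (by fun_prop)
  beta_reduce at hi
  rw [add_tsub_cancel_of_le hab] at hi
  rw [hi.integral_fun_mul_eq_mul_integral (hQ.mono (𝓕.le a) le_rfl).aestronglyMeasurable
    (hW.memLp_sub b a).1, hW.integral_sub_eq_zero, mul_zero]

variable [IsProbabilityMeasure P]

theorem integral_sub_mul_sub (hW : IsBrownianFor 𝓕 W P) {a b v : ℝ≥0} (hab : a ≤ b)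
    (hav : a ≤ v) :
    ∫ ω, (W b ω - W a ω) * (W v ω - W a ω) ∂P = min (b : ℝ) v - a := by
  have h : cov[fun ω => W b ω - W a ω, fun ω => W v ω - W a ω; P]
      = ∫ ω, (W b ω - W a ω) * (W v ω - W a ω) ∂P := by
    rw [covariance_eq_sub (hW.memLp_sub b a) (hW.memLp_sub v a), hW.integral_sub_eq_zero]
    simp
  rw [← h, covariance_fun_sub_fun_sub (hW.memLp _) (hW.memLp _) (hW.memLp _) (hW.memLp _)]
  simp_rw [hW.covariance_fun_eval]
  rw [min_eq_right hab, min_eq_left hav, min_self]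
  push_cast
  ring

theorem integral_mul_increment_mul_increment (hW : IsBrownianFor 𝓕 W P) {a b v : ℝ≥0}
    (hab : a ≤ b) (hav : a ≤ v) {Q : Ω → ℝ} (hQ : Measurable[𝓕 a] Q) :
    ∫ ω, Q ω * ((W b ω - W a ω) * (W v ω - W a ω)) ∂P
      = (∫ ω, Q ω ∂P) * (min (b : ℝ) v - a) := by
  have hi := hW.indepFun_comp_shift hQ (φ := fun f => f (b - a) * f (v - a)) (by fun_prop)
  beta_reduce at hi
  rw [add_tsub_cancel_of_le hab, add_tsub_cancel_of_le hav] at hi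
  rw [hi.integral_fun_mul_eq_mul_integral (hQ.mono (𝓕.le a) le_rfl).aestronglyMeasurable
    ((hW.memLp_sub b a).1.mul (hW.memLp_sub v a).1), hW.integral_sub_mul_sub hab hav]

/-- If `v ≤ a`, the increment over `(a, b]` is independent of the other factors and both sides
vanish. If `a ≤ v`, splitting `W v - W t` at `a` leaves only the overlap of `(a, b]` with `(a, v]`.
-/
theorem integral_coef_mul_increment_mul_sub (hW : IsBrownianFor 𝓕 W P) {t a b v : ℝ≥0}
    (hta : t ≤ a) (hab : a ≤ b) {c : Ω → ℝ} (hc : Measurable[𝓕 a] c) {C : ℝ}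
    (hC : ∀ ω, |c ω| ≤ C) :
    ∫ ω, c ω * (W b ω - W a ω) * (W v ω - W t ω) ∂P
      = (∫ ω, c ω ∂P) * (min (b : ℝ) v - min (a : ℝ) v) := by
  have hadapt : ∀ u ≤ a, Measurable[𝓕 a] (W u) := fun u hu =>
    (hW.adapted u).mono (𝓕.mono hu) le_rfl
  rcases le_total v a with hva | hav
  · have h : ∀ ω, c ω * (W b ω - W a ω) * (W v ω - W t ω)
        = (c ω * (W v ω - W t ω)) * (W b ω - W a ω) := fun ω => by ring
    simp_rw [h]
    have hm : Measurable[𝓕 a] fun ω => c ω * (W v ω - W t ω) :=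
      hc.mul ((hadapt v hva).sub (hadapt t hta))
    rw [hW.integral_mul_increment hab hm,
      min_eq_right (by exact_mod_cast hva.trans hab), min_eq_right (by exact_mod_cast hva)]
    ring
  · have h : ∀ ω, c ω * (W b ω - W a ω) * (W v ω - W t ω)
        = (c ω * (W a ω - W t ω)) * (W b ω - W a ω)
          + c ω * ((W b ω - W a ω) * (W v ω - W a ω)) := fun ω => by ring
    have hcm : Measurable c := hc.mono (𝓕.le a) le_rfl
    have h1 : Integrable (fun ω => (c ω * (W a ω - W t ω)) * (W b ω - W a ω)) P :=
      (hW.memLp_mul_increment hcm hC).integrable_mul (hW.memLp_sub b a)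
    have h2 : Integrable (fun ω => c ω * ((W b ω - W a ω) * (W v ω - W a ω))) P := by
      simp_rw [← mul_assoc]
      exact (hW.memLp_mul_increment hcm hC).integrable_mul (hW.memLp_sub v a)
    have hm : Measurable[𝓕 a] fun ω => c ω * (W a ω - W t ω) :=
      hc.mul ((hadapt a le_rfl).sub (hadapt t hta))
    simp_rw [h]
    rw [integral_add h1 h2, hW.integral_mul_increment hab hm,
      hW.integral_mul_increment_mul_increment hab hav hc,
      min_eq_left (a := (a : ℝ)) (b := v) (by exact_mod_cast hav),
      zero_add]

theorem integral_coef_mul_increment_sq (hW : IsBrownianFor 𝓕 W P) {a b : ℝ≥0} (hab : a ≤ b)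
    {c : Ω → ℝ} (hc : Measurable[𝓕 a] c) :
    ∫ ω, (c ω * (W b ω - W a ω)) * (c ω * (W b ω - W a ω)) ∂P
      = (∫ ω, c ω ^ 2 ∂P) * ((b : ℝ) - a) := by
  have h := hW.integral_mul_increment_mul_increment hab hab (hc.pow_const 2)
  rw [min_self] at h
  rw [← h]
  exact integral_congr_ae (ae_of_all _ fun ω => by ring)

/-- The Itô isometry for simple integrands. -/
theorem integral_sum_sq (hW : IsBrownianFor 𝓕 W P) (n : ℕ) {p : ℕ → ℝ≥0} (hp : Monotone p)
    {c : ℕ → Ω → ℝ} (hc : ∀ i, Measurable[𝓕 (p i)] (c i)) {C : ℝ} (hC : ∀ i ω, |c i ω| ≤ C) :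
    ∫ ω, (∑ i ∈ Finset.range n, c i ω * (W (p (i + 1)) ω - W (p i) ω)) ^ 2 ∂P
      = ∑ i ∈ Finset.range n, (∫ ω, c i ω ^ 2 ∂P) * ((p (i + 1) : ℝ) - p i) := by
  have hmem : ∀ i, MemLp (fun ω => c i ω * (W (p (i + 1)) ω - W (p i) ω)) 2 P := fun i =>
    hW.memLp_mul_increment ((hc i).mono (𝓕.le _) le_rfl) (hC i)
  -- The later increment is independent of all the other factors and centred, so cross terms vanish.
  have hlt : ∀ i j, i < j → ∫ ω, (c i ω * (W (p (i + 1)) ω - W (p i) ω)) *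
      (c j ω * (W (p (j + 1)) ω - W (p j) ω)) ∂P = 0 := by
    intro i j hij
    simp_rw [← mul_assoc]
    refine hW.integral_mul_increment (hp j.le_succ) (Measurable.mul (Measurable.mul ?_
      (Measurable.sub ?_ ?_)) (hc j))
    · exact (hc i).mono (𝓕.mono (hp hij.le)) le_rfl
    · exact (hW.adapted _).mono (𝓕.mono (hp hij)) le_rfl
    · exact (hW.adapted _).mono (𝓕.mono (hp hij.le)) le_rfl
  simp_rw [pow_two (Finset.sum _ _), Finset.sum_mul_sum]
  have hint : ∀ i j, Integrable (fun ω => (c i ω * (W (p (i + 1)) ω - W (p i) ω)) *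
      (c j ω * (W (p (j + 1)) ω - W (p j) ω))) P := fun i j => (hmem i).integrable_mul (hmem j)
  rw [integral_finsetSum _ fun i _ => integrable_finsetSum _ fun j _ => hint i j]
  refine Finset.sum_congr rfl fun i hi => ?_
  rw [integral_finsetSum _ fun j _ => hint i j,
    Finset.sum_eq_single_of_mem i hi, hW.integral_coef_mul_increment_sq (hp i.le_succ) (hc i)]
  intro j _ hji
  rcases hji.lt_or_gt with h | h
  · rw [← hlt j i h]
    exact integral_congr_ae (ae_of_all _ fun ω => by ring)
  · exact hlt i j h

end IsBrownianFor

/-! ### Time integrals of square integrable processes. -/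

/-- Cauchy–Schwarz, read off from `∫ (f - m)² ≥ 0` with `m` the mean of `f`. -/
theorem sq_intervalIntegral_le {f : ℝ → ℝ} (hf : Continuous f) {a b : ℝ} (hab : a ≤ b) :
    (∫ v in a..b, f v) ^ 2 ≤ (b - a) * ∫ v in a..b, f v ^ 2 := by
  rcases hab.eq_or_lt with rfl | hlt
  · simp
  have hpos : 0 < b - a := sub_pos.2 hlt
  set m := (∫ v in a..b, f v) / (b - a) with hm
  have h0 : 0 ≤ ∫ v in a..b, (f v - m) ^ 2 :=
    intervalIntegral.integral_nonneg hab fun v _ => sq_nonneg _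
  have h1 : ∀ v, (f v - m) ^ 2 = f v ^ 2 - 2 * m * f v + m ^ 2 := fun v => by ring
  simp_rw [h1] at h0
  rw [intervalIntegral.integral_add ((by fun_prop : Continuous _).intervalIntegrable _ _)
      intervalIntegrable_const,
    intervalIntegral.integral_sub ((by fun_prop : Continuous _).intervalIntegrable _ _)
      ((by fun_prop : Continuous _).intervalIntegrable _ _),
    intervalIntegral.integral_const_mul, intervalIntegral.integral_const, smul_eq_mul] at h0
  have h2 : (∫ v in a..b, f v) = m * (b - a) := by rw [hm]; field_simp
  rw [h2] at h0 ⊢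
  nlinarith [mul_nonneg hpos.le h0]

section

variable {Ω : Type*} {mΩ : MeasurableSpace Ω} {P : Measure Ω} [IsProbabilityMeasure P]

/-- Continuous paths give joint measurability, and a second moment bound uniform in `v` gives
integrability over the bounded window. This licenses Fubini below. -/
theorem memLp_prod_of_bounded_second_moment {B : ℝ → Ω → ℝ} (hc : ∀ ω, Continuous (B · ω))
    (hm : ∀ v, Measurable (B v)) {a b C : ℝ} (hB : ∀ v ∈ Set.Ioc a b, MemLp (B v) 2 P)
    (hC : ∀ v ∈ Set.Ioc a b, ∫ ω, B v ω ^ 2 ∂P ≤ C) :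
    MemLp (Function.uncurry B) 2 ((volume.restrict (Set.Ioc a b)).prod P) := by
  have hmB : Measurable (Function.uncurry B) := measurable_uncurry_of_continuous_of_measurable hc hm
  have hmB2 : Measurable fun z : ℝ × Ω => Function.uncurry B z ^ 2 := hmB.pow_const 2
  rw [memLp_two_iff_integrable_sq hmB.aestronglyMeasurable,
    integrable_prod_iff hmB2.aestronglyMeasurable]
  refine ⟨(ae_restrict_iff' measurableSet_Ioc).2 (ae_of_all _ fun v hv => (hB v hv).integrable_sq),
    ?_⟩
  refine Integrable.of_bound (C := C) ?_
    ((ae_restrict_iff' measurableSet_Ioc).2 (ae_of_all _ fun v hv => ?_))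
  · exact (StronglyMeasurable.integral_prod_right (f := fun v ω => ‖Function.uncurry B (v, ω) ^ 2‖)
      hmB2.norm.stronglyMeasurable).aestronglyMeasurable
  · rw [Real.norm_of_nonneg (integral_nonneg fun _ => norm_nonneg _)]
    simpa using hC v hv

theorem memLp_intervalIntegral {B : ℝ → Ω → ℝ} (hc : ∀ ω, Continuous (B · ω))
    (hm : ∀ v, Measurable (B v)) {a b C : ℝ} (hab : a ≤ b)
    (hB : ∀ v ∈ Set.Ioc a b, MemLp (B v) 2 P) (hC : ∀ v ∈ Set.Ioc a b, ∫ ω, B v ω ^ 2 ∂P ≤ C) :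
    MemLp (fun ω => ∫ v in a..b, B v ω) 2 P := by
  have hmB : Measurable (Function.uncurry B) := measurable_uncurry_of_continuous_of_measurable hc hm
  have hL := (memLp_prod_of_bounded_second_moment hc hm hB hC).integrable_sq
  have hsm : AEStronglyMeasurable (fun ω => ∫ v in a..b, B v ω) P := by
    simp_rw [intervalIntegral.integral_of_le hab]
    exact (StronglyMeasurable.integral_prod_left (f := B) hmB.stronglyMeasurable).aestronglyMeasurable
  rw [memLp_two_iff_integrable_sq hsm]
  refine Integrable.mono' (hL.integral_prod_right.const_mul (b - a)) (hsm.pow 2)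
    (ae_of_all _ fun ω => ?_)
  rw [Real.norm_of_nonneg (sq_nonneg _)]
  have := sq_intervalIntegral_le (hc ω) hab
  rwa [intervalIntegral.integral_of_le (f := fun v => B v ω ^ 2) hab] at this

theorem integral_mul_intervalIntegral {B : ℝ → Ω → ℝ} (hc : ∀ ω, Continuous (B · ω))
    (hm : ∀ v, Measurable (B v)) {a b C : ℝ} (hab : a ≤ b)
    (hB : ∀ v ∈ Set.Ioc a b, MemLp (B v) 2 P) (hC : ∀ v ∈ Set.Ioc a b, ∫ ω, B v ω ^ 2 ∂P ≤ C)
    {Q : Ω → ℝ} (hQ : MemLp Q 2 P) :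
    ∫ ω, Q ω * (∫ v in a..b, B v ω) ∂P = ∫ v in a..b, (∫ ω, Q ω * B v ω ∂P) := by
  have hL := memLp_prod_of_bounded_second_moment hc hm hB hC
  have hQ' : MemLp (fun z : ℝ × Ω => Q z.2) 2 ((volume.restrict (Set.Ioc a b)).prod P) :=
    hQ.comp_snd _
  simp_rw [intervalIntegral.integral_of_le hab, ← integral_const_mul]
  exact (integral_integral_swap (f := fun v ω => Q ω * B v ω) (hQ'.integrable_mul hL)).symm

end

/-! ### Wiener integrals of smooth deterministic functions. -/

/-- The pathwise expression, through integration by parts, of the integral of a deterministic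
function `h` with derivative `h'` against `W` over `[t, s]`. -/
noncomputable def wienerIntegral {Ω : Type*} (h h' : ℝ → ℝ) (W : ℝ≥0 → Ω → ℝ) (t s : ℝ≥0)
    (ω : Ω) : ℝ :=
  h s * (W s ω - W t ω) - ∫ v in (t : ℝ)..s, h' v * (W v.toNNReal ω - W t ω)

/-- The factor `min a v` is the Brownian covariance. It equals `v` up to `a`, where integration by
parts applies, and is constant afterwards. -/
theorem integral_deriv_mul_min {h h' : ℝ → ℝ} (hh : ∀ v, HasDerivAt h (h' v) v)
    (hh' : Continuous h') {t a s : ℝ} (hta : t ≤ a) (has : a ≤ s) :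
    ∫ v in t..s, h' v * min a v = a * h s - t * h t - ∫ v in t..a, h v := by
  have hc : Continuous h := continuous_iff_continuousAt.2 fun v => (hh v).continuousAt
  rw [← intervalIntegral.integral_add_adjacent_intervals (b := a)
    ((by fun_prop : Continuous _).intervalIntegrable _ _)
    ((by fun_prop : Continuous _).intervalIntegrable _ _)]
  have h1 : ∫ v in t..a, h' v * min a v = ∫ v in t..a, h' v * v := by
    refine intervalIntegral.integral_congr fun v hv => ?_
    rw [Set.uIcc_of_le hta] at hv
    simp only [min_eq_right hv.2]
  have h2 : ∫ v in a..s, h' v * min a v = ∫ v in a..s, h' v * a := by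
    refine intervalIntegral.integral_congr fun v hv => ?_
    rw [Set.uIcc_of_le has] at hv
    simp only [min_eq_left hv.1]
  have h3 := intervalIntegral.integral_deriv_mul_eq_sub (a := t) (b := a) (u := h) (u' := h')
    (v := fun v => v) (v' := fun _ => 1) (fun v _ => hh v) (fun v _ => hasDerivAt_id' v)
    (hh'.intervalIntegrable _ _) intervalIntegrable_const
  rw [intervalIntegral.integral_add ((by fun_prop : Continuous _).intervalIntegrable _ _)
    ((by fun_prop : Continuous _).intervalIntegrable _ _)] at h3
  simp only [mul_one] at h3
  rw [h1, h2, intervalIntegral.integral_mul_const,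
    intervalIntegral.integral_eq_sub_of_hasDerivAt (fun v _ => hh v) (hh'.intervalIntegrable _ _)]
  linarith

namespace IsBrownianFor

variable {Ω : Type*} {mΩ : MeasurableSpace Ω} {𝓕 : Filtration ℝ≥0 mΩ} {W : ℝ≥0 → Ω → ℝ}
  {P : Measure Ω}

theorem measurable (hW : IsBrownianFor 𝓕 W P) (v : ℝ≥0) : Measurable (W v) :=
  (hW.adapted v).mono (𝓕.le v) le_rfl

/-- A version of a Brownian motion all of whose paths are continuous. -/
theorem exists_continuous_version (hW : IsBrownianFor 𝓕 W P) :
    ∃ B : ℝ≥0 → Ω → ℝ, (∀ ω, Continuous (B · ω)) ∧ (∀ v, Measurable (B v)) ∧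
      ∀ᵐ ω ∂P, ∀ v, B v ω = W v ω := by
  classical
  obtain ⟨S, hS, hSm, hSc⟩ := hW.cont.exists_measurable_mem
  refine ⟨fun v ω => if ω ∈ S then W v ω else 0, fun ω => ?_, fun v => ?_, ?_⟩
  · by_cases hω : ω ∈ S
    · simpa [hω] using hSc ω hω
    · simpa [hω] using continuous_const
  · exact Measurable.ite hSm (hW.measurable v) measurable_const
  · filter_upwards [hS] with ω hω v
    simp [hω]

variable [IsProbabilityMeasure P] {h h' : ℝ → ℝ} {t s : ℝ≥0}

theorem exists_second_moment_bound (hW : IsBrownianFor 𝓕 W P) (hh' : Continuous h') (t s : ℝ≥0) :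
    ∃ C, ∀ v ∈ Set.Ioc (t : ℝ) s, ∫ ω, (h' v * (W v.toNNReal ω - W t ω)) ^ 2 ∂P ≤ C := by
  obtain ⟨C, hC⟩ := (isCompact_Icc (a := (t : ℝ)) (b := s)).exists_bound_of_continuousOn
    (f := fun v => h' v ^ 2 * (v - t)) (by fun_prop)
  refine ⟨C, fun v hv => ?_⟩
  have htv : t ≤ v.toNNReal := NNReal.le_toNNReal_of_coe_le hv.1.le
  have hv0 : 0 ≤ v := t.2.trans hv.1.le
  simp_rw [mul_pow, pow_two (W v.toNNReal _ - _)]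
  rw [integral_const_mul, hW.integral_sub_mul_sub htv htv, min_self, Real.coe_toNNReal v hv0]
  exact (le_abs_self _).trans (hC v ⟨hv.1.le, hv.2⟩)

theorem memLp_wienerIntegral (hW : IsBrownianFor 𝓕 W P) (hh' : Continuous h') (hts : t ≤ s) :
    MemLp (wienerIntegral h h' W t s) 2 P := by
  -- Joint measurability in time and `ω` is derived from continuity of every path, whereas `W` has
  -- continuous paths only almost surely.
  obtain ⟨B, hBc, hBm, hBW⟩ := hW.exists_continuous_version
  obtain ⟨C, hC⟩ := hW.exists_second_moment_bound hh' t s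
  have hae : ∀ v, (fun ω => h' v * (W v.toNNReal ω - W t ω)) =ᵐ[P]
      fun ω => h' v * (B v.toNNReal ω - B t ω) := fun v => by
    filter_upwards [hBW] with ω hω
    rw [hω, hω]
  refine ((hW.memLp_sub s t).const_mul (h s)).sub (MemLp.ae_eq ?_ (memLp_intervalIntegral
    (B := fun v ω => h' v * (B v.toNNReal ω - B t ω)) (fun ω => ?_) (fun v => ?_)
    (a := t) (b := s) (C := C) (by exact_mod_cast hts) (fun v _ => ?_) fun v hv => ?_))
  · filter_upwards [hBW] with ω hω
    simp_rw [hω]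
  · exact hh'.mul (((hBc ω).comp continuous_real_toNNReal).sub continuous_const)
  · exact ((hBm _).sub (hBm _)).const_mul _
  · exact ((hW.memLp_sub _ _).const_mul (h' v)).ae_eq (hae v)
  · refine le_of_eq_of_le (integral_congr_ae ?_) (hC v hv)
    filter_upwards [hae v] with ω hω
    rw [hω]

/-- Fubini reduces the pairing of `Q` with a Wiener integral to its pairings `g` with increments. It
is applied with `Q` a summand of an elementary integral and with `Q` the Wiener integral itself. -/
theorem integral_mul_wienerIntegral (hW : IsBrownianFor 𝓕 W P) (hh' : Continuous h')
    (hts : t ≤ s) {Q : Ω → ℝ} (hQ : MemLp Q 2 P) {g : ℝ → ℝ}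
    (hg : ∀ v : ℝ≥0, t ≤ v → v ≤ s → ∫ ω, Q ω * (W v ω - W t ω) ∂P = g v) :
    ∫ ω, Q ω * wienerIntegral h h' W t s ω ∂P
      = h s * g s - ∫ v in (t : ℝ)..s, h' v * g v := by
  obtain ⟨B, hBc, hBm, hBW⟩ := hW.exists_continuous_version
  obtain ⟨C, hC⟩ := hW.exists_second_moment_bound hh' t s
  have hae : ∀ v, (fun ω => h' v * (W v.toNNReal ω - W t ω)) =ᵐ[P]
      fun ω => h' v * (B v.toNNReal ω - B t ω) := fun v => by
    filter_upwards [hBW] with ω hω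
    rw [hω, hω]
  have hts' : (t : ℝ) ≤ s := by exact_mod_cast hts
  have hF := integral_mul_intervalIntegral (P := P)
    (B := fun v ω => h' v * (B v.toNNReal ω - B t ω))
    (fun ω => hh'.mul (((hBc ω).comp continuous_real_toNNReal).sub continuous_const))
    (fun v => ((hBm _).sub (hBm _)).const_mul _) (C := C) hts'
    (fun v _ => ((hW.memLp_sub _ _).const_mul (h' v)).ae_eq (hae v))
    (fun v hv => le_of_eq_of_le (integral_congr_ae (by
      filter_upwards [hae v] with ω hω
      rw [hω])) (hC v hv)) hQ
  -- For `h = 0` the Wiener integral is minus the correction integral, which is therefore square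
  -- integrable.
  have hL := (hW.memLp_wienerIntegral (h := 0) hh' hts)
  have hL' : MemLp (fun ω => ∫ v in (t : ℝ)..s, h' v * (W v.toNNReal ω - W t ω)) 2 P := by
    refine hL.neg.ae_eq (ae_of_all _ fun ω => ?_)
    simp [wienerIntegral]
  have e : ∀ ω, Q ω * wienerIntegral h h' W t s ω = h s * (Q ω * (W s ω - W t ω))
      - Q ω * ∫ v in (t : ℝ)..s, h' v * (W v.toNNReal ω - W t ω) := fun ω => by
    rw [wienerIntegral]; ring
  have i1 : Integrable (fun ω => h s * (Q ω * (W s ω - W t ω))) P :=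
    (hQ.integrable_mul (hW.memLp_sub s t)).const_mul _
  have i2 : Integrable (fun ω => Q ω * ∫ v in (t : ℝ)..s, h' v * (W v.toNNReal ω - W t ω)) P :=
    hQ.integrable_mul hL'
  simp_rw [e]
  rw [integral_sub i1 i2, integral_const_mul, hg s hts le_rfl]
  congr 1
  calc _ = ∫ ω, Q ω * (∫ v in (t : ℝ)..s, h' v * (B v.toNNReal ω - B t ω)) ∂P := by
        refine integral_congr_ae ?_
        filter_upwards [hBW] with ω hω
        simp_rw [hω]
    _ = _ := hF
    _ = _ := by
        refine intervalIntegral.integral_congr fun v hv => ?_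
        rw [Set.uIcc_of_le hts'] at hv
        have hv0 : 0 ≤ v := t.2.trans hv.1
        have h1 := hg v.toNNReal (NNReal.le_toNNReal_of_coe_le hv.1)
          (Real.toNNReal_le_iff_le_coe.2 hv.2)
        rw [Real.coe_toNNReal v hv0] at h1
        rw [← h1, ← integral_const_mul]
        refine integral_congr_ae ?_
        filter_upwards [hBW] with ω hω
        rw [hω, hω]
        ring

/-- The cross term of the isometry. The boundary values of `h` cancel in the integration by parts,
leaving the integral of `h` over the overlap. -/
theorem integral_coef_mul_increment_mul_wienerIntegral (hW : IsBrownianFor 𝓕 W P)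
    (hh : ∀ v, HasDerivAt h (h' v) v) (hh' : Continuous h') {a b : ℝ≥0} (hta : t ≤ a)
    (hab : a ≤ b) (hbs : b ≤ s) {c : Ω → ℝ} (hc : Measurable[𝓕 a] c) {C : ℝ}
    (hC : ∀ ω, |c ω| ≤ C) :
    ∫ ω, c ω * (W b ω - W a ω) * wienerIntegral h h' W t s ω ∂P
      = (∫ ω, c ω ∂P) * ∫ v in (a : ℝ)..b, h v := by
  have hcont : Continuous h := continuous_iff_continuousAt.2 fun v => (hh v).continuousAt
  have hta' : (t : ℝ) ≤ a := by exact_mod_cast hta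
  have hab' : (a : ℝ) ≤ b := by exact_mod_cast hab
  have hbs' : (b : ℝ) ≤ s := by exact_mod_cast hbs
  rw [hW.integral_mul_wienerIntegral hh' (hta.trans (hab.trans hbs))
    (hW.memLp_mul_increment (hc.mono (𝓕.le a) le_rfl) hC)
    (g := fun v => (∫ ω, c ω ∂P) * (min (b : ℝ) v - min (a : ℝ) v))
    (fun v _ _ => hW.integral_coef_mul_increment_mul_sub hta hab hc hC)]
  have e : ∀ v, h' v * ((∫ ω, c ω ∂P) * (min (b : ℝ) v - min (a : ℝ) v))
      = (∫ ω, c ω ∂P) * (h' v * min (b : ℝ) v - h' v * min (a : ℝ) v) := fun v => by ring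
  simp_rw [e]
  rw [intervalIntegral.integral_const_mul, intervalIntegral.integral_sub
    ((by fun_prop : Continuous _).intervalIntegrable _ _)
    ((by fun_prop : Continuous _).intervalIntegrable _ _),
    integral_deriv_mul_min hh hh' (hta'.trans hab') hbs',
    integral_deriv_mul_min hh hh' hta' (hab'.trans hbs'), min_eq_left hbs',
    min_eq_left (hab'.trans hbs'), ← intervalIntegral.integral_interval_sub_left
      (hcont.intervalIntegrable (t : ℝ) b) (hcont.intervalIntegrable (t : ℝ) a)]
  ring

/-- Pairing with an increment gives `g u = ∫_t^u h` (the cross term with `c = 1`); a second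
integration by parts turns this into `∫ h²`. -/
theorem integral_wienerIntegral_sq (hW : IsBrownianFor 𝓕 W P)
    (hh : ∀ v, HasDerivAt h (h' v) v) (hh' : Continuous h') (hts : t ≤ s) :
    ∫ ω, wienerIntegral h h' W t s ω ^ 2 ∂P = ∫ v in (t : ℝ)..s, h v ^ 2 := by
  have hcont : Continuous h := continuous_iff_continuousAt.2 fun v => (hh v).continuousAt
  simp_rw [pow_two]
  rw [hW.integral_mul_wienerIntegral hh' hts (hW.memLp_wienerIntegral hh' hts)
    (g := fun u => ∫ v in (t : ℝ)..u, h v)]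
  · have hp := intervalIntegral.integral_mul_deriv_eq_deriv_mul (a := (t : ℝ)) (b := s)
      (u := h) (u' := h') (v := fun u => ∫ v in (t : ℝ)..u, h v) (v' := h) (fun v _ => hh v)
      (fun v _ => intervalIntegral.integral_hasDerivAt_right (hcont.intervalIntegrable _ _)
        (hcont.stronglyMeasurableAtFilter _ _) hcont.continuousAt) (hh'.intervalIntegrable _ _)
      (hcont.intervalIntegrable _ _)
    rw [hp, intervalIntegral.integral_same]
    ring
  · intro v htv hvs
    have h1 := hW.integral_coef_mul_increment_mul_wienerIntegral hh hh' le_rfl htv hvs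
      (c := fun _ => 1) measurable_const (C := 1) (by simp)
    simp only [one_mul, integral_const, probReal_univ, smul_eq_mul] at h1
    rw [← h1]
    exact integral_congr_ae (ae_of_all _ fun ω => mul_comm _ _)

end IsBrownianFor

/-! ### Simple integrands restricted to a time window. -/

namespace SimpleIntegrand

variable {Ω : Type*} {mΩ : MeasurableSpace Ω} {𝓕 : Filtration ℝ≥0 mΩ} (V : SimpleIntegrand 𝓕)

/-- The partition points of a simple process, clamped to `[t, s]`. -/
def clampedTime (t s : ℝ≥0) (i : ℕ) : ℝ≥0 := min (max (V.time i) t) s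

/-- The coefficients of a simple process, set to zero when they are only known after time `s`. -/
noncomputable def truncatedCoef (s : ℝ≥0) (i : ℕ) (ω : Ω) : ℝ :=
  if V.time i ≤ s then V.coef i ω else 0

theorem clampedTime_mono (t s : ℝ≥0) : Monotone (V.clampedTime t s) := fun _ _ hij =>
  min_le_min_right _ (max_le_max_right _ (V.time_mono hij))

theorem le_clampedTime {t s : ℝ≥0} (hts : t ≤ s) (i : ℕ) : t ≤ V.clampedTime t s i :=
  le_min (le_max_right _ _) hts

theorem clampedTime_le (t s : ℝ≥0) (i : ℕ) : V.clampedTime t s i ≤ s := min_le_right _ _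

/-- When `V.time i` exceeds `s`, the clamped time is `s`, at which the coefficient need not be known
yet; replacing it by zero restores adaptedness. -/
theorem measurable_truncatedCoef (t s : ℝ≥0) (i : ℕ) :
    Measurable[𝓕 (V.clampedTime t s i)] (V.truncatedCoef s i) := by
  by_cases h : V.time i ≤ s
  · have e : V.truncatedCoef s i = V.coef i := by ext ω; simp [truncatedCoef, h]
    rw [e]
    exact (V.coef_measurable i).mono (𝓕.mono (le_min (le_max_left _ _) h)) le_rfl
  · have e : V.truncatedCoef s i = fun _ => 0 := by ext ω; simp [truncatedCoef, h]
    rw [e]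
    exact measurable_const

theorem exists_truncatedCoef_bound (s : ℝ≥0) : ∃ C : ℝ, ∀ i ω, |V.truncatedCoef s i ω| ≤ C := by
  obtain ⟨C, hC⟩ := V.coef_bounded
  refine ⟨C, fun i ω => ?_⟩
  by_cases h : V.time i ≤ s
  · simpa [truncatedCoef, h] using hC i ω
  · simpa [truncatedCoef, h] using (abs_nonneg _).trans (hC i ω)

theorem clampedTime_succ_eq {t s : ℝ≥0} {i : ℕ} (h : ¬ V.time i ≤ s) :
    V.clampedTime t s (i + 1) = V.clampedTime t s i := by
  have h1 : s ≤ V.time i := (not_le.1 h).le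
  have h2 : s ≤ V.time (i + 1) := h1.trans (V.time_mono i.le_succ)
  rw [clampedTime, clampedTime, min_eq_right (le_max_of_le_left h2),
    min_eq_right (le_max_of_le_left h1)]

/-- Truncation costs nothing: a coefficient is dropped only when its clamped interval is degenerate.
-/
theorem integral_eq_sum (W : ℝ≥0 → Ω → ℝ) (t s : ℝ≥0) (ω : Ω) :
    V.integral W t s ω = ∑ i ∈ Finset.range V.n, V.truncatedCoef s i ω *
      (W (V.clampedTime t s (i + 1)) ω - W (V.clampedTime t s i) ω) := by
  refine Finset.sum_congr rfl fun i _ => ?_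
  by_cases h : V.time i ≤ s
  · simp [truncatedCoef, h, clampedTime]
  · change _ * (W (V.clampedTime t s (i + 1)) ω - W (V.clampedTime t s i) ω) = _
    rw [V.clampedTime_succ_eq h, sub_self, mul_zero, mul_zero]

/-- The intervals of the partition are disjoint, so the square of the sum has no mixed terms. -/
theorem value_sub_sq (v : ℝ≥0) (ω : Ω) (y : ℝ) :
    (V.value v ω - y) ^ 2 = (∑ i ∈ Finset.range V.n,
      (Set.Ioc (V.time i) (V.time (i + 1))).indicator
        (fun _ => V.coef i ω ^ 2 - 2 * V.coef i ω * y) v) + y ^ 2 := by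
  have hdisj : ∀ i j, i < j → v ∈ Set.Ioc (V.time i) (V.time (i + 1)) →
      v ∉ Set.Ioc (V.time j) (V.time (j + 1)) := fun i j hij hi hj =>
    absurd (hi.2.trans (V.time_mono hij)) (not_le.2 hj.1)
  have hsq : V.value v ω ^ 2 = ∑ i ∈ Finset.range V.n,
      (Set.Ioc (V.time i) (V.time (i + 1))).indicator (fun _ => V.coef i ω ^ 2) v := by
    rw [value, pow_two, Finset.sum_mul_sum]
    refine Finset.sum_congr rfl fun i hi => ?_
    rw [Finset.sum_eq_single_of_mem i hi]
    · by_cases hv : v ∈ Set.Ioc (V.time i) (V.time (i + 1))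
      · simp only [Set.indicator_of_mem hv]; ring
      · simp only [Set.indicator_of_notMem hv]; ring
    · intro j _ hji
      by_cases hv : v ∈ Set.Ioc (V.time i) (V.time (i + 1))
      · have hv' : v ∉ Set.Ioc (V.time j) (V.time (j + 1)) := by
          rcases hji.lt_or_gt with h | h
          · exact fun h' => hdisj j i h h' hv
          · exact hdisj i j h hv
        rw [Set.indicator_of_notMem hv', mul_zero]
      · rw [Set.indicator_of_notMem hv, zero_mul]
  rw [sub_sq, hsq, value, Finset.mul_sum, Finset.sum_mul, ← Finset.sum_sub_distrib]
  congr 1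
  refine Finset.sum_congr rfl fun i _ => ?_
  by_cases hv : v ∈ Set.Ioc (V.time i) (V.time (i + 1))
  · simp only [Set.indicator_of_mem hv]
  · simp only [Set.indicator_of_notMem hv]; ring

theorem Ioc_inter_Ioc_time (t s : ℝ≥0) (i : ℕ) :
    Set.Ioc t s ∩ Set.Ioc (V.time i) (V.time (i + 1))
      = Set.Ioc (V.clampedTime t s i) (V.clampedTime t s (i + 1)) := by
  ext v
  simp only [Set.mem_inter_iff, Set.mem_Ioc, clampedTime, min_lt_iff, max_lt_iff, le_min_iff,
    le_max_iff]
  constructor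
  · rintro ⟨⟨h1, h2⟩, h3, h4⟩
    exact ⟨Or.inl ⟨h3, h1⟩, Or.inl h4, h2⟩
  · rintro ⟨h1 | h1, h2, h3⟩
    · exact ⟨⟨h1.2, h3⟩, h1.1, h2.resolve_right (not_le.2 h1.2)⟩
    · exact absurd h3 (not_le.2 h1)

/-- The nonnegativity is recorded alongside the formula because `ENNReal.ofReal` forgets it, and it
is needed again to turn the outer integral over `ω` into a real one. -/
theorem lintegral_value_sub_sq {h : ℝ → ℝ} (hh : Continuous h) {t s : ℝ≥0} (hts : t ≤ s) (ω : Ω) :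
    0 ≤ (∑ i ∈ Finset.range V.n, (V.truncatedCoef s i ω ^ 2 *
          ((V.clampedTime t s (i + 1) : ℝ) - V.clampedTime t s i)
        - 2 * (V.truncatedCoef s i ω *
          ∫ v in (V.clampedTime t s i : ℝ)..V.clampedTime t s (i + 1), h v)))
        + ∫ v in (t : ℝ)..s, h v ^ 2 ∧
    ∫⁻ v in Set.Ioc t s, ENNReal.ofReal ((V.value v ω - h v) ^ 2) ∂timeMeasure
      = ENNReal.ofReal ((∑ i ∈ Finset.range V.n, (V.truncatedCoef s i ω ^ 2 *
          ((V.clampedTime t s (i + 1) : ℝ) - V.clampedTime t s i)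
        - 2 * (V.truncatedCoef s i ω *
          ∫ v in (V.clampedTime t s i : ℝ)..V.clampedTime t s (i + 1), h v)))
        + ∫ v in (t : ℝ)..s, h v ^ 2) := by
  have hcont : ∀ k : ℝ → ℝ, Continuous k → ∀ a b : ℝ≥0,
      IntegrableOn (fun v : ℝ≥0 => k v) (Set.Ioc a b) timeMeasure := fun k hk a b =>
    integrableOn_timeMeasure (hk.integrableOn_Ioc)
  have hind : ∀ i, IntegrableOn (fun v : ℝ≥0 => (Set.Ioc (V.time i) (V.time (i + 1))).indicator
      (fun _ => V.coef i ω ^ 2 - 2 * V.coef i ω * h v) v) (Set.Ioc t s) timeMeasure := fun i =>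
    (hcont (fun v => V.coef i ω ^ 2 - 2 * V.coef i ω * h v) (by fun_prop) t s).indicator
      measurableSet_Ioc
  have hint : IntegrableOn (fun v : ℝ≥0 => (V.value v ω - h v) ^ 2) (Set.Ioc t s) timeMeasure := by
    simp_rw [value_sub_sq]
    exact (integrable_finsetSum _ fun i _ => hind i).add (hcont (fun v => h v ^ 2) (by fun_prop) t s)
  have hval : ∫ v in Set.Ioc t s, (V.value v ω - h v) ^ 2 ∂timeMeasure
      = (∑ i ∈ Finset.range V.n, (V.truncatedCoef s i ω ^ 2 *
          ((V.clampedTime t s (i + 1) : ℝ) - V.clampedTime t s i)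
        - 2 * (V.truncatedCoef s i ω *
          ∫ v in (V.clampedTime t s i : ℝ)..V.clampedTime t s (i + 1), h v)))
        + ∫ v in (t : ℝ)..s, h v ^ 2 := by
    simp_rw [value_sub_sq]
    rw [integral_add (integrable_finsetSum _ fun i _ => hind i)
      (hcont (fun v => h v ^ 2) (by fun_prop) t s), integral_finsetSum _ fun i _ => hind i,
      setIntegral_timeMeasure (fun v => h v ^ 2) hts]
    congr 1
    refine Finset.sum_congr rfl fun i _ => ?_
    have e : ∀ v : ℝ≥0, (Set.Ioc (V.time i) (V.time (i + 1))).indicator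
        (fun _ => V.coef i ω ^ 2 - 2 * V.coef i ω * h v) v
        = (Set.Ioc (V.time i) (V.time (i + 1))).indicator
        (fun u : ℝ≥0 => V.coef i ω ^ 2 - 2 * V.coef i ω * h u) v := fun v => rfl
    simp_rw [e]
    rw [setIntegral_indicator measurableSet_Ioc, V.Ioc_inter_Ioc_time,
      setIntegral_timeMeasure (fun u => V.coef i ω ^ 2 - 2 * V.coef i ω * h u)
        (V.clampedTime_mono t s i.le_succ)]
    by_cases hi : V.time i ≤ s
    · rw [intervalIntegral.integral_sub intervalIntegrable_const
        ((by fun_prop : Continuous _).intervalIntegrable _ _),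
        intervalIntegral.integral_const, intervalIntegral.integral_const_mul]
      simp only [truncatedCoef, hi, if_true, smul_eq_mul]
      ring
    · rw [V.clampedTime_succ_eq hi]
      simp
  rw [← hval, ofReal_integral_eq_lintegral_ofReal hint (ae_of_all _ fun v => sq_nonneg _)]
  exact ⟨integral_nonneg fun v => sq_nonneg _, rfl⟩

end SimpleIntegrand

/-! ### Identification of the Itô integral with the Wiener integral. -/

section

variable {Ω : Type*} {mΩ : MeasurableSpace Ω} {𝓕 : Filtration ℝ≥0 mΩ} {W : ℝ≥0 → Ω → ℝ}
  {P : Measure Ω} [IsProbabilityMeasure P] {h h' : ℝ → ℝ} {t s T : ℝ≥0}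

/-- The `L²` distance between the integrals of a simple process and of a deterministic function
is the `L²` distance between the integrands. -/
theorem IsBrownianFor.lintegral_integral_sub_wienerIntegral_sq (hW : IsBrownianFor 𝓕 W P)
    (hh : ∀ v, HasDerivAt h (h' v) v) (hh' : Continuous h') (hts : t ≤ s)
    (V : SimpleIntegrand 𝓕) :
    ∫⁻ ω, ENNReal.ofReal ((V.integral W t s ω - wienerIntegral h h' W t s ω) ^ 2) ∂P
      = ∫⁻ ω, (∫⁻ v in Set.Ioc t s, ENNReal.ofReal ((V.value v ω - h v) ^ 2) ∂timeMeasure) ∂P := by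
  have hcont : Continuous h := continuous_iff_continuousAt.2 fun v => (hh v).continuousAt
  obtain ⟨C, hC⟩ := V.exists_truncatedCoef_bound s
  have hnonneg := fun ω => (V.lintegral_value_sub_sq hcont hts ω).1
  simp_rw [fun ω => (V.lintegral_value_sub_sq hcont hts ω).2, V.integral_eq_sum]
  set p := V.clampedTime t s
  set c := V.truncatedCoef s
  have hpm : Monotone p := V.clampedTime_mono t s
  have hcm : ∀ i, Measurable[𝓕 (p i)] (c i) := V.measurable_truncatedCoef t s
  have hcm' : ∀ i, Measurable (c i) := fun i => (hcm i).mono (𝓕.le _) le_rfl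
  have hc2 : ∀ i, MemLp (c i) 2 P := fun i =>
    MemLp.of_bound (hcm' i).aestronglyMeasurable C (ae_of_all _ (hC i))
  have hmem : ∀ i, MemLp (fun ω => c i ω * (W (p (i + 1)) ω - W (p i) ω)) 2 P := fun i =>
    hW.memLp_mul_increment (hcm' i) (hC i)
  have hY := hW.memLp_wienerIntegral (h := h) hh' hts
  have hS : MemLp (fun ω => ∑ i ∈ Finset.range V.n, c i ω * (W (p (i + 1)) ω - W (p i) ω)) 2 P :=
    memLp_finsetSum _ fun i _ => hmem i
  have hterm : ∀ i, Integrable (fun ω => c i ω ^ 2 * ((p (i + 1) : ℝ) - p i)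
      - 2 * (c i ω * ∫ v in (p i : ℝ)..p (i + 1), h v)) P := fun i =>
    ((hc2 i).integrable_sq.mul_const _).sub
      ((((hc2 i).integrable one_le_two).mul_const _).const_mul _)
  have hdiff : Integrable (fun ω => ((∑ i ∈ Finset.range V.n, c i ω *
      (W (p (i + 1)) ω - W (p i) ω)) - wienerIntegral h h' W t s ω) ^ 2) P :=
    (hS.sub hY).integrable_sq
  have hsum : Integrable (fun ω => (∑ i ∈ Finset.range V.n, (c i ω ^ 2 * ((p (i + 1) : ℝ) - p i)
      - 2 * (c i ω * ∫ v in (p i : ℝ)..p (i + 1), h v))) + ∫ v in (t : ℝ)..s, h v ^ 2) P :=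
    (integrable_finsetSum _ fun i _ => hterm i).add (integrable_const _)
  rw [← ofReal_integral_eq_lintegral_ofReal hdiff (ae_of_all _ fun ω => sq_nonneg _),
    ← ofReal_integral_eq_lintegral_ofReal hsum (ae_of_all _ hnonneg)]
  congr 1
  have hcross : ∫ ω, (∑ i ∈ Finset.range V.n, c i ω * (W (p (i + 1)) ω - W (p i) ω))
      * wienerIntegral h h' W t s ω ∂P
      = ∑ i ∈ Finset.range V.n, (∫ ω, c i ω ∂P) * ∫ v in (p i : ℝ)..p (i + 1), h v := by
    simp_rw [Finset.sum_mul]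
    have hint : ∀ i, Integrable (fun ω => c i ω * (W (p (i + 1)) ω - W (p i) ω) *
        wienerIntegral h h' W t s ω) P := fun i => (hmem i).integrable_mul hY
    rw [integral_finsetSum _ fun i _ => hint i]
    exact Finset.sum_congr rfl fun i _ => hW.integral_coef_mul_increment_mul_wienerIntegral hh hh'
      (V.le_clampedTime hts i) (hpm i.le_succ) (V.clampedTime_le t s _) (hcm i) (hC i)
  have hSY : Integrable (fun ω => 2 * ((∑ i ∈ Finset.range V.n,
      c i ω * (W (p (i + 1)) ω - W (p i) ω)) * wienerIntegral h h' W t s ω)) P :=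
    (hS.integrable_mul hY).const_mul 2
  have hSSY : Integrable (fun ω => (∑ i ∈ Finset.range V.n,
      c i ω * (W (p (i + 1)) ω - W (p i) ω)) ^ 2 - 2 * ((∑ i ∈ Finset.range V.n,
      c i ω * (W (p (i + 1)) ω - W (p i) ω)) * wienerIntegral h h' W t s ω)) P :=
    hS.integrable_sq.sub hSY
  -- The square expands into the isometry for simple integrands, the cross term and the isometry for
  -- Wiener integrals, which match the time integral term by term.
  simp_rw [sub_sq, mul_assoc (2 : ℝ)]
  rw [integral_add hSSY hY.integrable_sq,
    integral_sub hS.integrable_sq hSY, integral_const_mul, hcross,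
    hW.integral_sum_sq _ hpm hcm hC, hW.integral_wienerIntegral_sq hh hh' hts,
    integral_add (integrable_finsetSum _ fun i _ => hterm i) (integrable_const _),
    integral_finsetSum _ fun i _ => hterm i, integral_const, probReal_univ, one_smul,
    Finset.mul_sum, ← Finset.sum_sub_distrib]
  congr 1
  refine Finset.sum_congr rfl fun i _ => ?_
  rw [integral_sub ((hc2 i).integrable_sq.mul_const _)
    ((((hc2 i).integrable one_le_two).mul_const _).const_mul _), integral_mul_const,
    integral_const_mul, integral_mul_const]

/-- The elementary integrals of the approximants converge in `L²` to `I s` by definition and to the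
Wiener integral by the isometry, so the limits agree. -/
theorem IsItoIntegral.ae_eq_wienerIntegral (hW : IsBrownianFor 𝓕 W P)
    (hh : ∀ v, HasDerivAt h (h' v) v) (hh' : Continuous h') {I : ℝ≥0 → Ω → ℝ}
    (hI : IsItoIntegral 𝓕 P W (fun v _ => h v) t T I) (hts : t ≤ s) (hsT : s ≤ T) :
    I s =ᵐ[P] wienerIntegral h h' W t s := by
  obtain ⟨V, hV, hVI⟩ := hI.approx
  have hIm : Measurable (I s) := (hI.adapted s ⟨hts, hsT⟩).mono (𝓕.le s) le_rfl
  have hY := (hW.memLp_wienerIntegral (h := h) hh' hts).1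
  have hVm : ∀ k, Measurable ((V k).integral W t s) := fun k =>
    Finset.measurable_fun_sum _ fun i _ =>
      (((V k).coef_measurable i).mono (𝓕.le _) le_rfl).mul ((hW.measurable _).sub (hW.measurable _))
  have h1 : Tendsto (fun k => ∫⁻ ω,
      ENNReal.ofReal (((V k).integral W t s ω - wienerIntegral h h' W t s ω) ^ 2) ∂P)
      atTop (𝓝 0) := by
    refine tendsto_of_tendsto_of_tendsto_of_le_of_le tendsto_const_nhds hV (fun _ => zero_le)
      fun k => ?_
    beta_reduce
    rw [hW.lintegral_integral_sub_wienerIntegral_sq hh hh' hts]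
    exact lintegral_mono fun ω => lintegral_mono_set (Set.Ioc_subset_Ioc_right hsT)
  have h2 := (hVI s ⟨hts, hsT⟩).add h1
  rw [add_zero] at h2
  -- The factor 2 comes from `(x - y)² ≤ 2((a - x)² + (a - y)²)`, with `a` the elementary integral.
  have h3 : Tendsto (fun k => 2 * (∫⁻ ω, ENNReal.ofReal (((V k).integral W t s ω - I s ω) ^ 2) ∂P
      + ∫⁻ ω, ENNReal.ofReal (((V k).integral W t s ω - wienerIntegral h h' W t s ω) ^ 2) ∂P))
      atTop (𝓝 0) := by
    simpa using ENNReal.Tendsto.const_mul h2 (Or.inr ENNReal.ofNat_ne_top)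
  have h4 : ∫⁻ ω, ENNReal.ofReal ((I s ω - wienerIntegral h h' W t s ω) ^ 2) ∂P = 0 := by
    refine le_antisymm (ge_of_tendsto' h3 fun k => ?_) zero_le
    have hm1 : Measurable fun ω => ENNReal.ofReal (((V k).integral W t s ω - I s ω) ^ 2) :=
      (((hVm k).sub hIm).pow_const 2).ennreal_ofReal
    rw [← lintegral_add_left hm1, ← lintegral_const_mul' _ _ ENNReal.ofNat_ne_top]
    refine lintegral_mono fun ω => ?_
    rw [← ENNReal.ofReal_add (sq_nonneg _) (sq_nonneg _), ← ENNReal.ofReal_ofNat 2,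
      ← ENNReal.ofReal_mul zero_le_two]
    refine ENNReal.ofReal_le_ofReal ?_
    nlinarith [sq_nonneg (((V k).integral W t s ω - I s ω)
      + ((V k).integral W t s ω - wienerIntegral h h' W t s ω))]
  have hm : AEMeasurable (fun ω =>
      ENNReal.ofReal ((I s ω - wienerIntegral h h' W t s ω) ^ 2)) P :=
    ((hIm.aemeasurable.sub hY.aemeasurable).pow_const 2).ennreal_ofReal
  rw [lintegral_eq_zero_iff' hm] at h4
  filter_upwards [h4] with ω hω
  simp only [Pi.zero_apply, ENNReal.ofReal_eq_zero] at hω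
  have := pow_eq_zero_iff (two_ne_zero) |>.1 (le_antisymm hω (sq_nonneg _))
  exact sub_eq_zero.1 this

theorem continuous_wienerIntegral (hh : Continuous h) (hh' : Continuous h') {t : ℝ≥0} {ω : Ω}
    (hω : Continuous (W · ω)) : Continuous fun s => wienerIntegral h h' W t s ω := by
  have h1 : Continuous fun v : ℝ => h' v * (W v.toNNReal ω - W t ω) :=
    hh'.mul ((hω.comp continuous_real_toNNReal).sub continuous_const)
  have h2 : Continuous fun u : ℝ => ∫ v in (t : ℝ)..u, h' v * (W v.toNNReal ω - W t ω) :=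
    intervalIntegral.continuous_primitive (fun a b => h1.intervalIntegrable a b) _
  exact ((hh.comp NNReal.continuous_coe).mul (hω.sub continuous_const)).sub
    (h2.comp NNReal.continuous_coe)

/-- The Itô integral of a deterministic differentiable function is given by integration by
parts. -/
theorem IsItoIntegral.ae_forall_eq_wienerIntegral (hW : IsBrownianFor 𝓕 W P)
    (hh : ∀ v, HasDerivAt h (h' v) v) (hh' : Continuous h') {I : ℝ≥0 → Ω → ℝ}
    (hI : IsItoIntegral 𝓕 P W (fun v _ => h v) t T I) :
    ∀ᵐ ω ∂P, ∀ s ∈ Set.Icc t T, I s ω = wienerIntegral h h' W t s ω := by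
  have hcont : Continuous h := continuous_iff_continuousAt.2 fun v => (hh v).continuousAt
  -- The exceptional null set depends on `s`. A countable dense set of times and path continuity
  -- make it uniform.
  obtain ⟨D, hDc, hDd⟩ := TopologicalSpace.exists_countable_dense (Set.Icc t T)
  have hD : ∀ᵐ ω ∂P, ∀ s ∈ D, I s ω = wienerIntegral h h' W t s ω :=
    (ae_ball_iff hDc).2 fun s _ => hI.ae_eq_wienerIntegral hW hh hh' s.2.1 s.2.2
  filter_upwards [hD, hI.continuous, hW.cont] with ω h1 h2 h3 s hs
  have h4 := Continuous.ext_on hDd (continuousOn_iff_continuous_domRestrict.1 h2)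
    ((continuous_wienerIntegral hcont hh' (t := t) h3).comp continuous_subtype_val)
    (fun s hs => h1 s hs)
  exact congr_fun h4 ⟨s, hs⟩

end

/-! ### Pathwise tools: a linear integral equation and integration by parts for jumps. -/

theorem eq_zero_of_eq_integral_mul {d : ℝ → ℝ} {a b r : ℝ}
    (hint : IntegrableOn d (Set.Ioc a b)) (hd : ∀ s ∈ Set.Icc a b, d s = ∫ u in a..s, r * d u) :
    ∀ s ∈ Set.Icc a b, d s = 0 := by
  intro s hs
  have hab : a ≤ b := hs.1.trans hs.2
  have hint' : IntegrableOn (fun u => r * d u) (Set.Icc a b) :=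
    ((integrableOn_Icc_iff_integrableOn_Ioc (by simp)).2 hint).const_mul r
  -- The equation improves its own solution: integrability gives continuity, continuity gives a
  -- right derivative, and Grönwall's inequality then applies.
  have hcont : ContinuousOn d (Set.Icc a b) :=
    (intervalIntegral.continuousOn_primitive_Icc hint').congr fun s hs => by
      simp only
      rw [hd s hs, intervalIntegral.integral_of_le hs.1, integral_Icc_eq_integral_Ioc]
  have ha : d a = 0 := by
    rw [hd a ⟨le_rfl, hab⟩, intervalIntegral.integral_same]
  have hderiv : ∀ x ∈ Set.Ico a b, HasDerivWithinAt d (r * d x) (Set.Ici x) x := by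
    intro x hx
    have hxI : x ∈ Set.Icc a b := ⟨hx.1, hx.2.le⟩
    have h1 : HasDerivWithinAt (fun s => ∫ u in a..s, r * d u) (r * d x) (Set.Icc a b) x := by
      have hm : Fact (x ∈ Set.Icc a b) := ⟨hxI⟩
      refine intervalIntegral.integral_hasDerivWithinAt_right ?_ ?_ ?_
      · rw [intervalIntegrable_iff_integrableOn_Ioc_of_le hx.1]
        exact hint'.mono_set (fun u hu => ⟨hu.1.le, hu.2.trans hx.2.le⟩)
      · exact (hcont.const_smul r).stronglyMeasurableAtFilter_nhdsWithin measurableSet_Icc x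
      · exact (hcont.const_smul r) x hxI
    have h2 := h1.congr hd (hd x hxI)
    refine h2.mono_of_mem_nhdsWithin ?_
    filter_upwards [Ico_mem_nhdsGE hx.2] with u hu
    exact ⟨hx.1.trans hu.1, hu.2.le⟩
  refine eq_zero_of_abs_deriv_le_mul_abs_self_of_eq_zero_right (K := |r|) hcont hderiv ha
    (fun x _ => ?_) s hs
  rw [Real.norm_eq_abs, abs_mul, Real.norm_eq_abs]

/-- Uniqueness for `y s = n s + ∫_a^s (r y + f)`. No regularity of `y` is assumed. -/
theorem eq_of_eq_add_integral {y z n f : ℝ → ℝ} {a b r : ℝ} (hr : r ≠ 0)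
    (hz : ContinuousOn f (Set.Icc a b)) (hzi : IntegrableOn z (Set.Ioc a b))
    (hzm : ∀ s ∈ Set.Icc a b, z s = n s + ∫ u in a..s, (r * z u + f u))
    (hy : ∀ s ∈ Set.Icc a b, y s = n s + ∫ u in a..s, (r * y u + f u)) :
    ∀ s ∈ Set.Icc a b, y s = z s := by
  intro s₀ hs₀
  have hab : a ≤ b := hs₀.1.trans hs₀.2
  have hfi : IntegrableOn f (Set.Ioc a b) :=
    (hz.integrableOn_compact isCompact_Icc).mono_set Set.Ioc_subset_Icc_self
  have hgz : IntegrableOn (fun u => r * z u + f u) (Set.Ioc a b) := (hzi.const_mul r).add hfi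
  have key : ∀ s ∈ Set.Icc a b, IntegrableOn (fun u => r * y u + f u) (Set.Ioc a s) → y s = z s := by
    intro s hs hgy
    have hsub : Set.Ioc a s ⊆ Set.Ioc a b := Set.Ioc_subset_Ioc_right hs.2
    -- As `r ≠ 0`, the difference `y - z` is `r⁻¹` times the difference of two integrable functions.
    have hd : IntegrableOn (fun u => y u - z u) (Set.Ioc a s) := by
      have h1 := ((hgy.sub (hgz.mono_set hsub)).const_mul r⁻¹)
      refine h1.congr (ae_of_all _ fun u => ?_)
      simp only [Pi.sub_apply]
      field_simp
      ring
    have h0 := eq_zero_of_eq_integral_mul (r := r) hd (fun v hv => ?_) s ⟨hs.1, le_rfl⟩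
    · exact sub_eq_zero.1 h0
    · have hvb : v ∈ Set.Icc a b := ⟨hv.1, hv.2.trans hs.2⟩
      have i1 : IntervalIntegrable (fun u => r * y u + f u) volume a v :=
        (intervalIntegrable_iff_integrableOn_Ioc_of_le hv.1).2
          (hgy.mono_set (Set.Ioc_subset_Ioc_right hv.2))
      have i2 : IntervalIntegrable (fun u => r * z u + f u) volume a v :=
        (intervalIntegrable_iff_integrableOn_Ioc_of_le hv.1).2
          (hgz.mono_set (Set.Ioc_subset_Ioc_right hvb.2))
      rw [hy v hvb, hzm v hvb, add_sub_add_left_eq_sub, ← intervalIntegral.integral_sub i1 i2]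
      exact intervalIntegral.integral_congr fun u _ => by ring
  -- The endpoints up to which the integrand is integrable. Beyond them the integral is 0 by
  -- convention and the equation reads `y s = n s`. Order-connectedness makes `S` measurable.
  let S : Set ℝ := {s | IntegrableOn (fun u => r * y u + f u) (Set.Ioc a s)}
  have hSo : S.OrdConnected := by
    refine ⟨fun u _ v hv w hw => ?_⟩
    exact IntegrableOn.mono_set hv (Set.Ioc_subset_Ioc_right hw.2)
  -- `y` agrees with `z` on `S` and with the integrable function `n` off `S`
  have hyi : IntegrableOn y (Set.Ioc a b) := by
    classical
    have hn : IntegrableOn n (Set.Ioc a b) := by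
      have hp : ContinuousOn (fun s => ∫ u in a..s, (r * z u + f u)) (Set.Icc a b) :=
        (intervalIntegral.continuousOn_primitive_Icc
          ((integrableOn_Icc_iff_integrableOn_Ioc (by simp)).2 hgz)).congr fun s hs => by
          simp only
          rw [intervalIntegral.integral_of_le hs.1, integral_Icc_eq_integral_Ioc]
      have hp' : IntegrableOn (fun s => ∫ u in a..s, (r * z u + f u)) (Set.Ioc a b) :=
        (hp.integrableOn_compact isCompact_Icc).mono_set Set.Ioc_subset_Icc_self
      refine IntegrableOn.congr_fun (hzi.sub hp') (fun s hs => ?_) measurableSet_Ioc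
      simp only [Pi.sub_apply]
      rw [hzm s ⟨hs.1.le, hs.2⟩]
      ring
    have hpw : IntegrableOn (S.piecewise z n) (Set.Ioc a b) := by
      have := Integrable.piecewise (μ := volume.restrict (Set.Ioc a b)) (f := z) (g := n)
        hSo.measurableSet hzi.integrableOn hn.integrableOn
      exact this
    refine hpw.congr_fun (fun s hs => ?_) measurableSet_Ioc
    have hsI : s ∈ Set.Icc a b := ⟨hs.1.le, hs.2⟩
    by_cases hsS : s ∈ S
    · rw [Set.piecewise_eq_of_mem _ _ _ hsS, key s hsI hsS]
    · rw [Set.piecewise_eq_of_notMem _ _ _ hsS, hy s hsI, intervalIntegral.integral_undef, add_zero]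
      rwa [intervalIntegrable_iff_integrableOn_Ioc_of_le hs.1.le]
  have hgy : IntegrableOn (fun u => r * y u + f u) (Set.Ioc a b) := (hyi.const_mul r).add hfi
  exact key s₀ hs₀ (hgy.mono_set (Set.Ioc_subset_Ioc_right hs₀.2))

/-- Integration by parts for `h` and the jump process `s ↦ ∫_{(t, s] × ℝ} γ dN`. -/
theorem setIntegral_mul_eq_sub_intervalIntegral {h h' : ℝ → ℝ}
    (hh : ∀ v, HasDerivAt h (h' v) v) (hh' : Continuous h') {γ : ℝ → ℝ} {t T s : ℝ≥0}
    {N : Measure (ℝ≥0 × ℝ)} (hfin : N (Set.Ioc t T ×ˢ Set.univ) ≠ ∞)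
    (hγ : IntegrableOn (fun q : ℝ≥0 × ℝ => γ q.2) (Set.Ioc t T ×ˢ Set.univ) N) (hts : t ≤ s)
    (hsT : s ≤ T) :
    ∫ q in Set.Ioc t s ×ˢ Set.univ, h q.1 * γ q.2 ∂N
      = h s * (∫ q in Set.Ioc t s ×ˢ Set.univ, γ q.2 ∂N)
        - ∫ v in (t : ℝ)..s, h' v * (∫ q in Set.Ioc t v.toNNReal ×ˢ Set.univ, γ q.2 ∂N) := by
  have hcont : Continuous h := continuous_iff_continuousAt.2 fun v => (hh v).continuousAt
  have hts' : (t : ℝ) ≤ s := by exact_mod_cast hts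
  set A : Set (ℝ≥0 × ℝ) := Set.Ioc t s ×ˢ Set.univ with hA
  have hAm : MeasurableSet A := measurableSet_Ioc.prod MeasurableSet.univ
  have hAT : A ⊆ Set.Ioc t T ×ˢ Set.univ :=
    Set.prod_mono (Set.Ioc_subset_Ioc_right hsT) le_rfl
  have hfinA : IsFiniteMeasure (N.restrict A) :=
    ⟨by rw [Measure.restrict_apply_univ]; exact (measure_mono hAT).trans_lt hfin.lt_top⟩
  have hγA : IntegrableOn (fun q : ℝ≥0 × ℝ => γ q.2) A N := hγ.mono_set hAT
  -- Fubini on the region where the jump time is at most `v`. Integrating over jumps first gives the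
  -- total up to `v`; integrating over `v` first gives `h s - h q.1` for a jump at `q.1`.
  let D : Set (ℝ × (ℝ≥0 × ℝ)) := {z | (z.2.1 : ℝ) ≤ z.1}
  have hD : MeasurableSet D := measurableSet_le (by fun_prop) (by fun_prop)
  have hF : Integrable (Function.uncurry fun (v : ℝ) (q : ℝ≥0 × ℝ) =>
      D.indicator (fun z => h' z.1 * γ z.2.2) (v, q))
      ((volume.restrict (Set.Ioc (t : ℝ) s)).prod (N.restrict A)) := by
    have h1 : Integrable (fun z : ℝ × (ℝ≥0 × ℝ) => h' z.1 * γ z.2.2)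
        ((volume.restrict (Set.Ioc (t : ℝ) s)).prod (N.restrict A)) :=
      Integrable.mul_prod (f := h') (g := fun q : ℝ≥0 × ℝ => γ q.2)
        hh'.integrableOn_Ioc hγA
    exact h1.indicator hD
  have hswap := integral_integral_swap hF
  have hleft : ∫ v in Set.Ioc (t : ℝ) s, (∫ q in A, D.indicator
      (fun z => h' z.1 * γ z.2.2) (v, q) ∂N)
      = ∫ v in (t : ℝ)..s, h' v * (∫ q in Set.Ioc t v.toNNReal ×ˢ Set.univ, γ q.2 ∂N) := by
    rw [intervalIntegral.integral_of_le hts']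
    refine setIntegral_congr_fun measurableSet_Ioc fun v hv => ?_
    have hv0 : 0 ≤ v := t.2.trans hv.1.le
    have hset : A ∩ {q : ℝ≥0 × ℝ | (q.1 : ℝ) ≤ v} = Set.Ioc t v.toNNReal ×ˢ Set.univ := by
      ext q
      simp only [hA, Set.mem_inter_iff, Set.mem_prod, Set.mem_Ioc, Set.mem_univ, and_true,
        Set.mem_ofPred_eq, Real.le_toNNReal_iff_coe_le hv0]
      constructor
      · rintro ⟨⟨h1, _⟩, h2⟩
        exact ⟨h1, h2⟩
      · rintro ⟨h1, h2⟩
        exact ⟨⟨h1, by exact_mod_cast h2.trans hv.2⟩, h2⟩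
    have e : ∀ q : ℝ≥0 × ℝ, D.indicator (fun z => h' z.1 * γ z.2.2) (v, q)
        = {q : ℝ≥0 × ℝ | (q.1 : ℝ) ≤ v}.indicator (fun q => h' v * γ q.2) q := fun q => rfl
    simp_rw [e]
    rw [setIntegral_indicator (measurableSet_le (by fun_prop) (by fun_prop)), hset,
      integral_const_mul]
  have hright : ∫ q in A, (∫ v in Set.Ioc (t : ℝ) s, D.indicator
      (fun z => h' z.1 * γ z.2.2) (v, q)) ∂N
      = ∫ q in A, (h s * γ q.2 - h q.1 * γ q.2) ∂N := by
    refine setIntegral_congr_fun hAm fun q hq => ?_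
    have hq1 : (t : ℝ) < q.1 := by exact_mod_cast hq.1.1
    have hq2 : (q.1 : ℝ) ≤ s := by exact_mod_cast hq.1.2
    have e : ∀ v : ℝ, D.indicator (fun z => h' z.1 * γ z.2.2) (v, q)
        = (Set.Ici (q.1 : ℝ)).indicator (fun v => h' v * γ q.2) v := fun v => rfl
    have hset : Set.Ioc (t : ℝ) s ∩ Set.Ici (q.1 : ℝ) = Set.Icc (q.1 : ℝ) s := by
      ext v
      simp only [Set.mem_inter_iff, Set.mem_Ioc, Set.mem_Ici, Set.mem_Icc]
      constructor
      · rintro ⟨⟨_, h2⟩, h3⟩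
        exact ⟨h3, h2⟩
      · rintro ⟨h1, h2⟩
        exact ⟨⟨hq1.trans_le h1, h2⟩, h1⟩
    simp_rw [e]
    rw [setIntegral_indicator measurableSet_Ici, hset, integral_Icc_eq_integral_Ioc,
      ← intervalIntegral.integral_of_le hq2, intervalIntegral.integral_mul_const,
      intervalIntegral.integral_eq_sub_of_hasDerivAt (fun v _ => hh v)
        (hh'.intervalIntegrable _ _)]
    ring
  have hhγ : IntegrableOn (fun q : ℝ≥0 × ℝ => h q.1 * γ q.2) A N := by
    obtain ⟨C, hC⟩ := (isCompact_Icc (a := (t : ℝ)) (b := s)).exists_bound_of_continuousOn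
      hcont.continuousOn
    refine Integrable.bdd_mul (c := C) hγA (by fun_prop)
      ((ae_restrict_iff' hAm).2 (ae_of_all _ fun q hq => hC _ ⟨?_, ?_⟩))
    · exact_mod_cast hq.1.1.le
    · exact_mod_cast hq.1.2
  rw [hleft, hright, integral_sub (hγA.const_mul _) hhγ, integral_const_mul] at hswap
  rw [hswap]
  ring

/-! ### The claims process: measurability, independence and moments. -/

instance : SigmaFinite timeMeasure := by
  refine ⟨⟨⟨fun n => Set.Iic (n : ℝ≥0), fun _ => trivial, fun n => ?_, ?_⟩⟩⟩
  -- The point 0 is split off because `timeMeasure_Ioc` treats only left-open intervals.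
  · refine (measure_mono (t := Set.Ioc 0 (n : ℝ≥0) ∪ {0}) fun v hv => ?_).trans_lt ?_
    · rcases eq_or_ne v 0 with rfl | h
      · exact Or.inr rfl
      · exact Or.inl ⟨pos_iff_ne_zero.2 h, hv⟩
    · refine (measure_union_le _ _).trans_lt (ENNReal.add_lt_top.2 ⟨?_, ?_⟩)
      · rw [timeMeasure_Ioc]; exact ENNReal.ofReal_lt_top
      · rw [timeMeasure, measurableEmbedding_nnreal_coe.comap_apply, Set.image_singleton,
          Real.volume_singleton]
        exact ENNReal.zero_lt_top
  · refine Set.eq_univ_of_forall fun v => Set.mem_iUnion.2 ?_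
    exact exists_nat_ge v

theorem measurable_increment_iSup_comap {Ω : Type*} (W : ℝ≥0 → Ω → ℝ) (t s : ℝ≥0) :
    Measurable[⨆ t, MeasurableSpace.comap (W t) inferInstance] fun ω => W s ω - W t ω := by
  have hm : ∀ u, Measurable[⨆ t, MeasurableSpace.comap (W t) inferInstance] (W u) :=
    fun u => (comap_measurable (W u)).mono
      (le_iSup (fun t => MeasurableSpace.comap (W t) inferInstance) u) le_rfl
  exact (hm s).sub (hm t)

namespace InsuranceMarket

variable {Ω : Type*} [mΩ : MeasurableSpace Ω] {P : Measure Ω} (M : InsuranceMarket P)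

/-- The total size of the claims with `(t, s]` as time window: `∫_{(t, s] × ℝ} γ(z) N(dv, dz)`. -/
noncomputable def claims (t s : ℝ≥0) (ω : Ω) : ℝ :=
  ∫ q in Set.Ioc t s ×ˢ Set.univ, M.γ q.2 ∂(M.N ω)

/-- The claim size as an extended nonnegative function of time and mark. -/
noncomputable def claimSize (q : ℝ≥0 × ℝ) : ℝ≥0∞ := ENNReal.ofReal (M.γ q.2)

theorem measurable_claimSize : Measurable M.claimSize :=
  (M.γ_measurable.comp measurable_snd).ennreal_ofReal

/-- No finiteness is needed: if the integral diverges, both sides take the default value 0.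
Measurability of the claims can thus be checked for all `ω`. -/
theorem claims_eq_toReal (t s : ℝ≥0) (ω : Ω) :
    M.claims t s ω = (∫⁻ q in Set.Ioc t s ×ˢ Set.univ, M.claimSize q ∂(M.N ω)).toReal :=
  integral_eq_lintegral_of_nonneg_ae (ae_of_all _ fun q => (M.γ_pos q.2).le)
    (M.γ_measurable.comp measurable_snd).aestronglyMeasurable

/-- Measurability is stated relative to the σ-algebra of `N`, which is what independence from the
Brownian motions requires. -/
theorem measurable_claims (t s : ℝ≥0) :
    Measurable[MeasurableSpace.comap M.N inferInstance] (M.claims t s) := by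
  have h : M.claims t s = (fun κ : Measure (ℝ≥0 × ℝ) =>
      (∫⁻ q, (Set.Ioc t s ×ˢ Set.univ).indicator M.claimSize q ∂κ).toReal) ∘ M.N := by
    ext ω
    rw [claims_eq_toReal, Function.comp_apply,
      lintegral_indicator (measurableSet_Ioc.prod MeasurableSet.univ)]
  rw [h]
  exact ((Measure.measurable_lintegral (M.measurable_claimSize.indicator
    (measurableSet_Ioc.prod MeasurableSet.univ))).ennreal_toReal).comp (comap_measurable M.N)

theorem measurable_claims' (t s : ℝ≥0) : Measurable (M.claims t s) :=
  (M.measurable_claims t s).mono M.N_poisson.measurable.comap_le le_rfl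

theorem γ₁_nonneg : 0 ≤ M.γ₁ := integral_nonneg fun z => (M.γ_pos z).le

theorem γ₂_nonneg : 0 ≤ M.γ₂ := integral_nonneg fun _ => sq_nonneg _

theorem claims_nonneg (t s : ℝ≥0) (ω : Ω) : 0 ≤ M.claims t s ω :=
  integral_nonneg fun q => (M.γ_pos q.2).le

theorem indepFun_increment_increment (t s : ℝ≥0) :
    IndepFun (fun ω => M.W₁ s ω - M.W₁ t ω) (fun ω => M.W₂ s ω - M.W₂ t ω) P :=
  (IndepFun_iff_Indep _ _ _).2 <|
    indep_of_indep_of_le (M.indep.indep (show (0 : Fin 4) ≠ 1 by decide))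
      (measurable_increment_iSup_comap M.W₁ t s).comap_le
      (measurable_increment_iSup_comap M.W₂ t s).comap_le

theorem indepFun_W₁_claims (t s : ℝ≥0) :
    IndepFun (fun ω => M.W₁ s ω - M.W₁ t ω) (M.claims t s) P :=
  (IndepFun_iff_Indep _ _ _).2 <|
    indep_of_indep_of_le (M.indep.indep (show (0 : Fin 4) ≠ 2 by decide))
      (measurable_increment_iSup_comap M.W₁ t s).comap_le (M.measurable_claims t s).comap_le

theorem indepFun_W₂_claims (t s : ℝ≥0) :
    IndepFun (fun ω => M.W₂ s ω - M.W₂ t ω) (M.claims t s) P :=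
  (IndepFun_iff_Indep _ _ _).2 <|
    indep_of_indep_of_le (M.indep.indep (show (1 : Fin 4) ≠ 2 by decide))
      (measurable_increment_iSup_comap M.W₂ t s).comap_le (M.measurable_claims t s).comap_le

variable [IsProbabilityMeasure P]

theorem isProbabilityMeasure_map_Z : IsProbabilityMeasure (P.map M.Z) :=
  Measure.isProbabilityMeasure_map M.Z_measurable.aemeasurable

theorem intensity_restrict (t s : ℝ≥0) :
    (ENNReal.ofReal M.lam • timeMeasure.prod (P.map M.Z)).restrict (Set.Ioc t s ×ˢ Set.univ)
      = ENNReal.ofReal M.lam • (timeMeasure.restrict (Set.Ioc t s)).prod (P.map M.Z) := by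
  have := M.isProbabilityMeasure_map_Z
  rw [Measure.restrict_smul, ← Measure.prod_restrict, Measure.restrict_univ]

theorem lintegral_intensity {t s : ℝ≥0} {f : ℝ → ℝ} (hf : Integrable f (P.map M.Z))
    (hfm : Measurable f) (hf0 : ∀ z, 0 ≤ f z) :
    ∫⁻ q in Set.Ioc t s ×ˢ Set.univ, ENNReal.ofReal (f q.2)
        ∂(ENNReal.ofReal M.lam • timeMeasure.prod (P.map M.Z))
      = ENNReal.ofReal (M.lam * ((s : ℝ) - t) * ∫ z, f z ∂(P.map M.Z)) := by
  have := M.isProbabilityMeasure_map_Z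
  rw [M.intensity_restrict, lintegral_smul_measure, lintegral_prod _ (by fun_prop)]
  simp only
  rw [lintegral_const, Measure.restrict_apply_univ, timeMeasure_Ioc,
    ← ofReal_integral_eq_lintegral_ofReal hf (ae_of_all _ hf0), smul_eq_mul, mul_assoc,
    ENNReal.ofReal_mul M.lam_nonneg, ENNReal.ofReal_mul' (integral_nonneg hf0),
    mul_comm (ENNReal.ofReal (∫ z, f z ∂(P.map M.Z)))]

theorem isFiniteMeasure_intensity_restrict (t s : ℝ≥0) : IsFiniteMeasure
    ((ENNReal.ofReal M.lam • timeMeasure.prod (P.map M.Z)).restrict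
      (Set.Ioc t s ×ˢ Set.univ)) := by
  have := M.isProbabilityMeasure_map_Z
  have h := M.lintegral_intensity (t := t) (s := s) (f := fun _ => 1) (integrable_const 1)
    measurable_const (fun _ => zero_le_one)
  simp only [ENNReal.ofReal_one, lintegral_one] at h
  exact ⟨by rw [h]; exact ENNReal.ofReal_lt_top⟩

theorem lintegral_claimSize (t s : ℝ≥0) :
    ∫⁻ ω, ∫⁻ q in Set.Ioc t s ×ˢ Set.univ, M.claimSize q ∂(M.N ω) ∂P
      = ENNReal.ofReal (M.lam * ((s : ℝ) - t) * M.γ₁) := by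
  have := M.isFiniteMeasure_intensity_restrict t s
  rw [(M.N_poisson.restrict (measurableSet_Ioc.prod MeasurableSet.univ)).lintegral_lintegral
    M.measurable_claimSize]
  exact M.lintegral_intensity M.γ_integrable M.γ_measurable fun z => (M.γ_pos z).le

theorem lintegral_claimSize_sq (t s : ℝ≥0) :
    ∫⁻ ω, (∫⁻ q in Set.Ioc t s ×ˢ Set.univ, M.claimSize q ∂(M.N ω)) ^ 2 ∂P
      = ENNReal.ofReal (M.lam * ((s : ℝ) - t) * M.γ₂)
        + ENNReal.ofReal (M.lam * ((s : ℝ) - t) * M.γ₁) ^ 2 := by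
  have := M.isFiniteMeasure_intensity_restrict t s
  rw [(M.N_poisson.restrict (measurableSet_Ioc.prod MeasurableSet.univ)).lintegral_lintegral_sq
    M.measurable_claimSize]
  congr 1
  · have h := M.lintegral_intensity (t := t) (s := s) M.γ_sq_integrable
      (M.γ_measurable.pow_const 2) fun z => sq_nonneg _
    rw [γ₂, ← h]
    refine lintegral_congr fun q => ?_
    rw [claimSize, ENNReal.ofReal_pow (M.γ_pos _).le]
  · congr 1
    exact M.lintegral_intensity M.γ_integrable M.γ_measurable fun z => (M.γ_pos z).le

theorem ae_lintegral_claimSize_lt_top (t s : ℝ≥0) :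
    ∀ᵐ ω ∂P, ∫⁻ q in Set.Ioc t s ×ˢ Set.univ, M.claimSize q ∂(M.N ω) < ∞ := by
  refine ae_lt_top' ?_ (by rw [M.lintegral_claimSize]; exact ENNReal.ofReal_ne_top)
  exact ((Measure.measurable_lintegral M.measurable_claimSize).comp
    (M.N_poisson.restrict (measurableSet_Ioc.prod MeasurableSet.univ)).measurable).aemeasurable

/-- Almost sure finiteness rules out the default value, so Campbell's formulas for extended
integrals transfer to the real-valued claims. -/
theorem lintegral_ofReal_claims (t s : ℝ≥0) (n : ℕ) :
    ∫⁻ ω, ENNReal.ofReal (M.claims t s ω ^ n) ∂P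
      = ∫⁻ ω, (∫⁻ q in Set.Ioc t s ×ˢ Set.univ, M.claimSize q ∂(M.N ω)) ^ n ∂P := by
  refine lintegral_congr_ae ?_
  filter_upwards [M.ae_lintegral_claimSize_lt_top t s] with ω hω
  rw [M.claims_eq_toReal, ENNReal.ofReal_pow ENNReal.toReal_nonneg, ENNReal.ofReal_toReal hω.ne]

theorem memLp_claims (t s : ℝ≥0) : MemLp (M.claims t s) 2 P := by
  rw [memLp_two_iff_integrable_sq (M.measurable_claims' t s).aestronglyMeasurable]
  refine ⟨((M.measurable_claims' t s).pow_const 2).aestronglyMeasurable, ?_⟩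
  rw [hasFiniteIntegral_iff_ofReal (ae_of_all _ fun _ => sq_nonneg _),
    M.lintegral_ofReal_claims, M.lintegral_claimSize_sq]
  finiteness

theorem integral_claims {t s : ℝ≥0} (hts : t ≤ s) :
    ∫ ω, M.claims t s ω ∂P = M.lam * ((s : ℝ) - t) * M.γ₁ := by
  have hts' : (t : ℝ) ≤ s := by exact_mod_cast hts
  have h := M.lintegral_ofReal_claims t s 1
  simp only [pow_one] at h
  rw [integral_eq_lintegral_of_nonneg_ae (ae_of_all _ (M.claims_nonneg t s))
    (M.measurable_claims' t s).aestronglyMeasurable, h, M.lintegral_claimSize,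
    ENNReal.toReal_ofReal]
  exact mul_nonneg (mul_nonneg M.lam_nonneg (sub_nonneg.2 hts')) M.γ₁_nonneg

theorem variance_claims {t s : ℝ≥0} (hts : t ≤ s) :
    Var[M.claims t s; P] = M.lam * ((s : ℝ) - t) * M.γ₂ := by
  have hts' : (t : ℝ) ≤ s := by exact_mod_cast hts
  have h1 : 0 ≤ M.lam * ((s : ℝ) - t) * M.γ₁ :=
    mul_nonneg (mul_nonneg M.lam_nonneg (sub_nonneg.2 hts')) M.γ₁_nonneg
  have h2 : 0 ≤ M.lam * ((s : ℝ) - t) * M.γ₂ :=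
    mul_nonneg (mul_nonneg M.lam_nonneg (sub_nonneg.2 hts')) M.γ₂_nonneg
  rw [variance_eq_sub (M.memLp_claims t s), M.integral_claims hts]
  simp only [Pi.pow_apply]
  rw [integral_eq_lintegral_of_nonneg_ae (ae_of_all _ fun _ => sq_nonneg _)
    ((M.measurable_claims' t s).pow_const 2).aestronglyMeasurable, M.lintegral_ofReal_claims,
    M.lintegral_claimSize_sq, ← ENNReal.ofReal_pow h1, ← ENNReal.ofReal_add h2 (sq_nonneg _),
    ENNReal.toReal_ofReal (add_nonneg h2 (sq_nonneg _))]
  ring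

theorem ae_N_Ioc_ne_top (t T : ℝ≥0) : ∀ᵐ ω ∂P, M.N ω (Set.Ioc t T ×ˢ Set.univ) ≠ ∞ := by
  have hA : MeasurableSet (Set.Ioc t T ×ˢ (Set.univ : Set ℝ)) :=
    measurableSet_Ioc.prod MeasurableSet.univ
  have := M.isFiniteMeasure_intensity_restrict t T
  have hfin : (ENNReal.ofReal M.lam • timeMeasure.prod (P.map M.Z))
      (Set.Ioc t T ×ˢ Set.univ) ≠ ∞ := by
    rw [← Measure.restrict_apply_univ]
    exact measure_ne_top _ _
  filter_upwards [ae_lt_top (M.N_poisson.measurable_apply hA)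
    (by rwa [M.N_poisson.lintegral_apply hA hfin])] with ω hω using hω.ne

theorem ae_integrableOn_γ (t T : ℝ≥0) : ∀ᵐ ω ∂P,
    IntegrableOn (fun q : ℝ≥0 × ℝ => M.γ q.2) (Set.Ioc t T ×ˢ Set.univ) (M.N ω) := by
  filter_upwards [M.ae_lintegral_claimSize_lt_top t T] with ω hω
  refine ⟨(M.γ_measurable.comp measurable_snd).aestronglyMeasurable, ?_⟩
  rwa [hasFiniteIntegral_iff_ofReal (f := fun q : ℝ≥0 × ℝ => M.γ q.2)
    (ae_of_all _ fun q => (M.γ_pos q.2).le)]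

end InsuranceMarket

/-! ### Closed form of the optimal wealth, and its moments. -/

namespace InsuranceMarket

variable {Ω : Type*} [mΩ : MeasurableSpace Ω] {P : Measure Ω} (M : InsuranceMarket P)

/-- The discount factor from `T` back to `u`. -/
noncomputable def discount (T u : ℝ) : ℝ := Real.exp (-M.r * (T - u))

theorem hasDerivAt_discount (T u : ℝ) : HasDerivAt (M.discount T) (M.r * M.discount T u) u := by
  have h : HasDerivAt (fun u : ℝ => -M.r * (T - u)) M.r u := by
    have := ((hasDerivAt_id' u).const_sub T).const_mul (-M.r)
    simpa using this
  have h' := h.exp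
  rw [mul_comm] at h'
  exact h'

theorem continuous_discount (T : ℝ) : Continuous (M.discount T) :=
  continuous_iff_continuousAt.2 fun u => (M.hasDerivAt_discount T u).continuousAt

theorem hasDerivAt_const_mul_discount (c T u : ℝ) :
    HasDerivAt (fun u => c * M.discount T u) (c * (M.r * M.discount T u)) u :=
  (M.hasDerivAt_discount T u).const_mul c

/-- The driving noise of the wealth, discounted to the horizon, under the optimal strategy. -/
noncomputable def noise (θ : ℝ) (t s : ℝ≥0) (ω : Ω) : ℝ :=
  (M.σ * M.κ₁ - M.ρ * M.β * M.κ₂) / θ * (M.W₁ s ω - M.W₁ t ω)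
    - M.β * √(1 - M.ρ ^ 2) * M.κ₂ / θ * (M.W₂ s ω - M.W₂ t ω) - M.κ₂ / θ * M.claims t s ω

/-- Claims are positive, so their total is monotone in time; this yields integrability of the path
in time. -/
theorem claims_monotoneOn {t T : ℝ≥0} {ω : Ω}
    (hγ : IntegrableOn (fun q : ℝ≥0 × ℝ => M.γ q.2) (Set.Ioc t T ×ˢ Set.univ) (M.N ω)) :
    MonotoneOn (fun u : ℝ => M.claims t u.toNNReal ω) (Set.Icc (t : ℝ) T) := by
  intro u _ v hv huv
  refine setIntegral_mono_set (hγ.mono_set (Set.prod_mono (Set.Ioc_subset_Ioc_right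
    (Real.toNNReal_le_iff_le_coe.2 hv.2)) le_rfl)) (ae_of_all _ fun q => (M.γ_pos q.2).le) ?_
  exact (Set.prod_mono (Set.Ioc_subset_Ioc_right (Real.toNNReal_le_toNNReal huv))
    le_rfl).eventuallyLE

theorem mean_rate_eq_κ₃ :
    M.μbar * M.κ₁ + (M.pbar - M.lam * M.γ₁) * M.κ₂ = M.κ₃ := by
  have hD : M.β ^ 2 * (1 - M.ρ ^ 2) + M.lam * M.γ₂ ≠ 0 := M.nondegenerate
  have hσ := M.σ_pos.ne'
  rw [κ₁, κ₂, κ₃]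
  field_simp
  ring

theorem variance_rate_eq_κ₃ :
    (M.σ * M.κ₁ - M.ρ * M.β * M.κ₂) ^ 2 + M.β ^ 2 * (1 - M.ρ ^ 2) * M.κ₂ ^ 2
      + M.lam * M.γ₂ * M.κ₂ ^ 2 = M.κ₃ := by
  have hD : M.β ^ 2 * (1 - M.ρ ^ 2) + M.lam * M.γ₂ ≠ 0 := M.nondegenerate
  have hσ := M.σ_pos.ne'
  rw [κ₁, κ₂, κ₃]
  field_simp
  ring

/-- Completing the square: the numerator is `D μbar² + (ρ β μbar + (pbar - λ γ₁) σ)²` with `D > 0`,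
and its two squares vanish together only if `μbar` and `pbar - λ γ₁` both do. -/
theorem κ₃_pos (h : M.μbar ≠ 0 ∨ M.pbar - M.lam * M.γ₁ ≠ 0) : 0 < M.κ₃ := by
  have hρ : 0 ≤ 1 - M.ρ ^ 2 := by nlinarith [M.ρ_mem.1, M.ρ_mem.2]
  have hD : 0 < M.β ^ 2 * (1 - M.ρ ^ 2) + M.lam * M.γ₂ :=
    lt_of_le_of_ne (add_nonneg (mul_nonneg (sq_nonneg _) hρ)
      (mul_nonneg M.lam_nonneg M.γ₂_nonneg)) M.nondegenerate.symm
  refine div_pos ?_ (mul_pos hD (pow_pos M.σ_pos 2))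
  have e : (M.β ^ 2 + M.lam * M.γ₂) * M.μbar ^ 2
      + 2 * M.ρ * M.β * M.σ * M.μbar * (M.pbar - M.lam * M.γ₁)
      + (M.pbar - M.lam * M.γ₁) ^ 2 * M.σ ^ 2
      = (M.β ^ 2 * (1 - M.ρ ^ 2) + M.lam * M.γ₂) * M.μbar ^ 2
        + (M.ρ * M.β * M.μbar + (M.pbar - M.lam * M.γ₁) * M.σ) ^ 2 := by ring
  rw [e]
  by_cases hμ : M.μbar = 0
  · have hp := h.resolve_left (not_not.2 hμ)
    have : 0 < ((M.pbar - M.lam * M.γ₁) * M.σ) ^ 2 :=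
      sq_pos_of_ne_zero (mul_ne_zero hp M.σ_pos.ne')
    simpa [hμ] using this
  · exact add_pos_of_pos_of_nonneg (mul_pos hD (sq_pos_of_ne_zero hμ)) (sq_nonneg _)

variable [IsProbabilityMeasure P]

/-- The wealth under the optimal strategy in closed form. -/
theorem IsWealthPath.ae_eq {θ : ℝ} {t T : ℝ≥0} {x : ℝ} {X : ℝ≥0 → Ω → ℝ}
    (hX : M.IsWealthPath (M.optInvestment θ T) (M.optLiability θ T) t T x X) :
    ∀ᵐ ω ∂P, ∀ s ∈ Set.Icc t T, X s ω = x * Real.exp (M.r * ((s : ℝ) - t))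
      + (M.μbar * M.κ₁ + M.pbar * M.κ₂) / θ * M.discount T s * ((s : ℝ) - t)
      + M.discount T s * M.noise θ t s ω := by
  obtain ⟨I₁, I₂, hI₁, hI₂, hsde⟩ := hX.sde
  set c₁ := (M.σ * M.κ₁ - M.ρ * M.β * M.κ₂) / θ with hc₁
  set c₂ := M.β * √(1 - M.ρ ^ 2) * M.κ₂ / θ with hc₂
  set c₃ := M.κ₂ / θ with hc₃
  set K := (M.μbar * M.κ₁ + M.pbar * M.κ₂) / θ with hK
  have hψ := M.continuous_discount T
  have e₁ : (fun (v : ℝ≥0) (ω : Ω) => M.σ * M.optInvestment θ T v ω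
      - M.ρ * M.β * M.optLiability θ T v ω) = fun (v : ℝ≥0) _ => c₁ * M.discount T v := by
    ext v ω
    simp only [optInvestment, optLiability, discount, hc₁]
    ring
  have e₂ : (fun (v : ℝ≥0) (ω : Ω) => M.β * √(1 - M.ρ ^ 2) * M.optLiability θ T v ω)
      = fun (v : ℝ≥0) _ => c₂ * M.discount T v := by
    ext v ω
    simp only [optLiability, discount, hc₂]
    ring
  rw [e₁] at hI₁
  rw [e₂] at hI₂
  have hw₁ := IsItoIntegral.ae_forall_eq_wienerIntegral (h := fun u => c₁ * M.discount T u)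
    M.W₁_isBrownianFor (M.hasDerivAt_const_mul_discount c₁ T) (by fun_prop) hI₁
  have hw₂ := IsItoIntegral.ae_forall_eq_wienerIntegral (h := fun u => c₂ * M.discount T u)
    M.W₂_isBrownianFor (M.hasDerivAt_const_mul_discount c₂ T) (by fun_prop) hI₂
  filter_upwards [hsde, hw₁, hw₂, M.ae_N_Ioc_ne_top t T, M.ae_integrableOn_γ t T,
    M.W₁_brownian.cont, M.W₂_brownian.cont] with ω hω h₁ h₂ hN hγ hW₁ hW₂ s₀ hs₀
  have htT : (t : ℝ) ≤ T := by exact_mod_cast hs₀.1.trans hs₀.2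
  -- The paths are extended to real times through `Real.toNNReal`, so that interval integrals apply.
  set b₁ : ℝ → ℝ := fun u => M.W₁ u.toNNReal ω - M.W₁ t ω with hb₁
  set b₂ : ℝ → ℝ := fun u => M.W₂ u.toNNReal ω - M.W₂ t ω with hb₂
  set g : ℝ → ℝ := fun u => M.claims t u.toNNReal ω with hg
  set S : ℝ → ℝ := fun u => M.noise θ t u.toNNReal ω with hS
  have hS' : ∀ u, S u = c₁ * b₁ u - c₂ * b₂ u - c₃ * g u := fun u => rfl
  have hb₁c : Continuous b₁ := (hW₁.comp continuous_real_toNNReal).sub continuous_const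
  have hb₂c : Continuous b₂ := (hW₂.comp continuous_real_toNNReal).sub continuous_const
  have hgi : ∀ v ∈ Set.Icc (t : ℝ) T, IntervalIntegrable g volume t v := fun v hv =>
    MonotoneOn.intervalIntegrable (by
      rw [Set.uIcc_of_le hv.1]
      exact (M.claims_monotoneOn hγ).mono (Set.Icc_subset_Icc_right hv.2))
  have hSi : ∀ v ∈ Set.Icc (t : ℝ) T, IntervalIntegrable S volume t v := fun v hv =>
    (((hb₁c.intervalIntegrable _ _).const_mul c₁).sub
      ((hb₂c.intervalIntegrable _ _).const_mul c₂)).sub ((hgi v hv).const_mul c₃)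
  have hψS : ∀ v ∈ Set.Icc (t : ℝ) T, IntervalIntegrable (fun u => M.discount T u * S u)
      volume t v := fun v hv => (hSi v hv).continuousOn_mul hψ.continuousOn
  -- The noise-free solution: `m' = r m + K ψ` with `m t = x`.
  let m : ℝ → ℝ := fun u => x * Real.exp (M.r * (u - t)) + K * M.discount T u * (u - t)
  have hmc : Continuous m := by fun_prop
  have hm : ∀ u, HasDerivAt m (M.r * m u + K * M.discount T u) u := by
    intro u
    have h1 : HasDerivAt (fun u : ℝ => M.r * (u - t)) M.r u := by
      simpa using ((hasDerivAt_id' u).sub_const (t : ℝ)).const_mul M.r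
    have h2 := (h1.exp.const_mul x).add
      ((M.hasDerivAt_const_mul_discount K T u).mul ((hasDerivAt_id' u).sub_const (t : ℝ)))
    refine h2.congr_deriv ?_
    simp only [m]
    ring
  have hmint : ∀ v : ℝ, ∫ u in (t : ℝ)..v, (M.r * m u + K * M.discount T u) = m v - x := by
    intro v
    rw [intervalIntegral.integral_eq_sub_of_hasDerivAt (fun u _ => hm u)
      ((by fun_prop : Continuous _).intervalIntegrable _ _)]
    simp [m]
  -- the integrated noise, in terms of the closed form
  let n : ℝ → ℝ := fun u => x + M.discount T u * S u
    - ∫ v in (t : ℝ)..u, M.r * (M.discount T v * S v)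
  -- The integral subtracted in `n` cancels the interest `r ψ S` earned on the noise part, and `m`
  -- absorbs the rest.
  have hz : ∀ v ∈ Set.Icc (t : ℝ) T, m v + M.discount T v * S v
      = n v + ∫ u in (t : ℝ)..v, (M.r * (m u + M.discount T u * S u) + K * M.discount T u) := by
    intro v hv
    have e : ∀ u, M.r * (m u + M.discount T u * S u) + K * M.discount T u
        = (M.r * m u + K * M.discount T u) + M.r * (M.discount T u * S u) := fun u => by ring
    simp_rw [e]
    rw [intervalIntegral.integral_add ((by fun_prop : Continuous _).intervalIntegrable _ _)
      ((hψS v hv).const_mul _), hmint]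
    simp only [n]
    ring
  have hy : ∀ v ∈ Set.Icc (t : ℝ) T, X v.toNNReal ω
      = n v + ∫ u in (t : ℝ)..v, (M.r * X u.toNNReal ω + K * M.discount T u) := by
    intro v hv
    obtain ⟨s, rfl⟩ : ∃ s : ℝ≥0, v = s :=
      ⟨v.toNNReal, (Real.coe_toNNReal v (t.2.trans hv.1)).symm⟩
    have hts : t ≤ s := by exact_mod_cast hv.1
    have hsT : s ≤ T := by exact_mod_cast hv.2
    have hX0 := hω s ⟨hts, hsT⟩
    rw [Real.toNNReal_coe, hX0, h₁ s ⟨hts, hsT⟩, h₂ s ⟨hts, hsT⟩]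
    have hdrift : ∫ u in Set.Ioc t s, (M.r * X u ω + M.μbar * M.optInvestment θ T u ω
          + M.pbar * M.optLiability θ T u ω) ∂timeMeasure
        = ∫ u in (t : ℝ)..s, (M.r * X u.toNNReal ω + K * M.discount T u) := by
      rw [← setIntegral_timeMeasure _ hts]
      refine integral_congr_ae (ae_of_all _ fun u => ?_)
      simp only [Real.toNNReal_coe, optInvestment, optLiability, discount, hK]
      ring
    have hjump := setIntegral_mul_eq_sub_intervalIntegral
      (M.hasDerivAt_const_mul_discount c₃ T) (by fun_prop) hN hγ hts hsT
    have hjump' : ∫ q in Set.Ioc t s ×ˢ Set.univ, M.optLiability θ T q.1 ω * M.γ q.2 ∂(M.N ω)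
        = c₃ * M.discount T s * g s
          - ∫ v in (t : ℝ)..s, c₃ * (M.r * M.discount T v) * g v := by
      have hgs : g s = M.claims t s ω := by simp only [hg, Real.toNNReal_coe]
      rw [hgs]
      exact hjump
    rw [hdrift, hjump']
    have hw : ∀ (W : ℝ≥0 → Ω → ℝ) (c : ℝ), wienerIntegral (fun u => c * M.discount T u)
        (fun u => c * (M.r * M.discount T u)) W t s ω
        = c * M.discount T s * (W (s : ℝ).toNNReal ω - W t ω)
        - ∫ v in (t : ℝ)..s, c * (M.r * M.discount T v) * (W v.toNNReal ω - W t ω) := by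
      intro W c
      rw [wienerIntegral, Real.toNNReal_coe]
    rw [hw, hw]
    -- The three integrands are multiples of `ψ`, with derivatives the same multiples of `r ψ`, so
    -- their by-parts corrections combine into `∫ r ψ S`.
    have hsplit : ∫ v in (t : ℝ)..s, M.r * (M.discount T v * S v)
        = (∫ v in (t : ℝ)..s, c₁ * (M.r * M.discount T v) * b₁ v)
          - (∫ v in (t : ℝ)..s, c₂ * (M.r * M.discount T v) * b₂ v)
          - ∫ v in (t : ℝ)..s, c₃ * (M.r * M.discount T v) * g v := by
      have i₁ : IntervalIntegrable (fun v => c₁ * (M.r * M.discount T v) * b₁ v) volume t s :=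
        (by fun_prop : Continuous _).intervalIntegrable _ _
      have i₂ : IntervalIntegrable (fun v => c₂ * (M.r * M.discount T v) * b₂ v) volume t s :=
        (by fun_prop : Continuous _).intervalIntegrable _ _
      have i₃ : IntervalIntegrable (fun v => c₃ * (M.r * M.discount T v) * g v) volume t s :=
        (hgi s hv).continuousOn_mul (by fun_prop)
      rw [← intervalIntegral.integral_sub i₁ i₂, ← intervalIntegral.integral_sub (i₁.sub i₂) i₃]
      refine intervalIntegral.integral_congr fun v _ => ?_
      simp only [hS']
      ring
    simp only [n]
    rw [hsplit, hS']
    simp only [hb₁, hb₂]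
    ring
  have hfin := eq_of_eq_add_integral M.r_pos.ne' (z := fun v => m v + M.discount T v * S v)
    (y := fun v => X v.toNNReal ω) (n := n) (f := fun u => K * M.discount T u) (a := (t : ℝ))
    (b := T) (by fun_prop) ?_ hz hy s₀ ⟨by exact_mod_cast hs₀.1, by exact_mod_cast hs₀.2⟩
  · simpa only [Real.toNNReal_coe, hS, m] using hfin
  · refine hmc.integrableOn_Ioc.add ?_
    exact (intervalIntegrable_iff_integrableOn_Ioc_of_le htT).1 (hψS T ⟨htT, le_rfl⟩)

theorem memLp_noise (θ : ℝ) (t s : ℝ≥0) : MemLp (M.noise θ t s) 2 P :=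
  (((M.W₁_isBrownianFor.memLp_sub s t).const_mul _).sub
    ((M.W₂_isBrownianFor.memLp_sub s t).const_mul _)).sub ((M.memLp_claims t s).const_mul _)

theorem integral_noise (θ : ℝ) {t s : ℝ≥0} (hts : t ≤ s) :
    ∫ ω, M.noise θ t s ω ∂P = -(M.κ₂ / θ * (M.lam * ((s : ℝ) - t) * M.γ₁)) := by
  have i₁ := ((M.W₁_isBrownianFor.memLp_sub s t).integrable one_le_two).const_mul
    ((M.σ * M.κ₁ - M.ρ * M.β * M.κ₂) / θ)
  have i₂ := ((M.W₂_isBrownianFor.memLp_sub s t).integrable one_le_two).const_mul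
    (M.β * √(1 - M.ρ ^ 2) * M.κ₂ / θ)
  have i₃ := ((M.memLp_claims t s).integrable one_le_two).const_mul (M.κ₂ / θ)
  have i₁₂ : Integrable (fun ω => (M.σ * M.κ₁ - M.ρ * M.β * M.κ₂) / θ * (M.W₁ s ω - M.W₁ t ω)
      - M.β * √(1 - M.ρ ^ 2) * M.κ₂ / θ * (M.W₂ s ω - M.W₂ t ω)) P := i₁.sub i₂
  simp only [noise]
  rw [integral_sub i₁₂ i₃, integral_sub i₁ i₂, integral_const_mul, integral_const_mul,
    integral_const_mul, M.W₁_isBrownianFor.integral_sub_eq_zero,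
    M.W₂_isBrownianFor.integral_sub_eq_zero, M.integral_claims hts]
  ring

theorem variance_increment {𝓕 : Filtration ℝ≥0 mΩ} {W : ℝ≥0 → Ω → ℝ} (hW : IsBrownianFor 𝓕 W P)
    {t s : ℝ≥0} (hts : t ≤ s) : Var[fun ω => W s ω - W t ω; P] = (s : ℝ) - t := by
  rw [variance_eq_sub (hW.memLp_sub s t), hW.integral_sub_eq_zero]
  simp only [Pi.pow_apply, pow_two]
  rw [hW.integral_sub_mul_sub hts hts, min_self]
  ring

theorem variance_noise (θ : ℝ) {t s : ℝ≥0} (hts : t ≤ s) :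
    Var[M.noise θ t s; P] = ((M.σ * M.κ₁ - M.ρ * M.β * M.κ₂) ^ 2
      + M.β ^ 2 * (1 - M.ρ ^ 2) * M.κ₂ ^ 2 + M.lam * M.γ₂ * M.κ₂ ^ 2) / θ ^ 2 * ((s : ℝ) - t) := by
  have hρ : 0 ≤ 1 - M.ρ ^ 2 := by nlinarith [M.ρ_mem.1, M.ρ_mem.2]
  set B₁ : Ω → ℝ := fun ω => M.W₁ s ω - M.W₁ t ω with hB₁
  set B₂ : Ω → ℝ := fun ω => M.W₂ s ω - M.W₂ t ω with hB₂
  set c₁ := (M.σ * M.κ₁ - M.ρ * M.β * M.κ₂) / θ with hc₁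
  set c₂ := M.β * √(1 - M.ρ ^ 2) * M.κ₂ / θ with hc₂
  set c₃ := M.κ₂ / θ with hc₃
  have h₁ : MemLp B₁ 2 P := M.W₁_isBrownianFor.memLp_sub s t
  have h₂ : MemLp B₂ 2 P := M.W₂_isBrownianFor.memLp_sub s t
  have h₃ := M.memLp_claims t s
  have e : M.noise θ t s = fun ω => (c₁ * B₁ ω - c₂ * B₂ ω) - c₃ * M.claims t s ω := rfl
  have h₁₂ : MemLp (fun ω => c₁ * B₁ ω - c₂ * B₂ ω) 2 P := (h₁.const_mul c₁).sub (h₂.const_mul c₂)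
  rw [e, variance_fun_sub h₁₂ (h₃.const_mul c₃),
    variance_fun_sub (h₁.const_mul c₁) (h₂.const_mul c₂),
    covariance_fun_sub_left (h₁.const_mul c₁) (h₂.const_mul c₂) (h₃.const_mul c₃)]
  simp only [variance_const_mul, covariance_const_mul_left, covariance_const_mul_right]
  have hv₁ := variance_increment M.W₁_isBrownianFor hts
  have hv₂ := variance_increment M.W₂_isBrownianFor hts
  -- Pairwise independence of the three noise sources is enough to remove every covariance.
  rw [(M.indepFun_increment_increment t s).covariance_eq_zero h₁ h₂,
    (M.indepFun_W₁_claims t s).covariance_eq_zero h₁ h₃,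
    (M.indepFun_W₂_claims t s).covariance_eq_zero h₂ h₃, hv₁, hv₂, M.variance_claims hts]
  simp only [hc₁, hc₂, hc₃, div_pow, mul_pow, Real.sq_sqrt hρ]
  ring

end InsuranceMarket

namespace InsuranceMarket

variable {Ω : Type*} [MeasurableSpace Ω] {P : Measure Ω} [IsProbabilityMeasure P]
  (M : InsuranceMarket P)

/-- At a fixed time the wealth is almost surely a constant plus `ψ(s)` times the noise. The noise
mean `-κ₂ λ γ₁ (s-t)/θ` completes the drift rate to `κ₃/θ`, and the variance acquires the factor
`ψ(s)²`. -/
theorem IsWealthPath.memLp_and_integral_and_variance {θ : ℝ} {t T s : ℝ≥0} {x : ℝ}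
    {X : ℝ≥0 → Ω → ℝ}
    (hX : M.IsWealthPath (M.optInvestment θ T) (M.optLiability θ T) t T x X) (hts : t ≤ s)
    (hsT : s ≤ T) :
    MemLp (X s) 2 P ∧
    ∫ ω, X s ω ∂P = x * Real.exp (M.r * ((s : ℝ) - t))
      + M.κ₃ / θ * Real.exp (-M.r * ((T : ℝ) - s)) * ((s : ℝ) - t) ∧
    Var[X s; P] = M.κ₃ / θ ^ 2 * Real.exp (-2 * M.r * ((T : ℝ) - s)) * ((s : ℝ) - t) := by
  set m := x * Real.exp (M.r * ((s : ℝ) - t))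
    + (M.μbar * M.κ₁ + M.pbar * M.κ₂) / θ * M.discount T s * ((s : ℝ) - t) with hm
  have hae : X s =ᵐ[P] fun ω => m + M.discount T s * M.noise θ t s ω := by
    filter_upwards [hX.ae_eq] with ω hω using hω s ⟨hts, hsT⟩
  have hL := (M.memLp_noise θ t s).const_mul (M.discount T s)
  refine ⟨((memLp_const m).add hL).ae_eq hae.symm, ?_, ?_⟩
  · rw [integral_congr_ae hae, integral_add (integrable_const m) (hL.integrable one_le_two),
      integral_const, probReal_univ, one_smul, integral_const_mul,
      M.integral_noise θ hts, ← M.mean_rate_eq_κ₃, hm, discount]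
    ring
  · rw [variance_congr hae, variance_const_add hL.1, variance_const_mul, M.variance_noise θ hts,
      M.variance_rate_eq_κ₃]
    have : M.discount T s ^ 2 = Real.exp (-2 * M.r * ((T : ℝ) - s)) := by
      rw [discount, ← Real.exp_nat_mul]
      congr 1
      push_cast
      ring
    rw [this]
    ring

end InsuranceMarket

theorem proposition3p4 {Ω : Type*} [MeasurableSpace Ω] (P : Measure Ω) [IsProbabilityMeasure P]
    (M : InsuranceMarket P) (θ : ℝ) (hθ : 0 < θ) (t T : ℝ≥0) (htT : t ≤ T) (x : ℝ)
    (X : ℝ≥0 → Ω → ℝ)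
    (hX : M.IsWealthPath (M.optInvestment θ T) (M.optLiability θ T) t T x X) :
    -- the algebraic identities
    (M.μbar * M.κ₁ + (M.pbar - M.lam * M.γ₁) * M.κ₂ = M.κ₃ ∧
      (M.σ * M.κ₁ - M.ρ * M.β * M.κ₂) ^ 2 + M.β ^ 2 * (1 - M.ρ ^ 2) * M.κ₂ ^ 2
        + M.lam * M.γ₂ * M.κ₂ ^ 2 = M.κ₃ ∧
      ((M.μbar ≠ 0 ∨ M.pbar - M.lam * M.γ₁ ≠ 0) → 0 < M.κ₃)) ∧
    -- mean, variance and mean-variance tradeoff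
    (∀ s : ℝ≥0, t ≤ s → s ≤ T →
      MemLp (X s) 2 P ∧
      ∫ ω, X s ω ∂P = x * Real.exp (M.r * ((s : ℝ) - t))
        + M.κ₃ / θ * Real.exp (-M.r * ((T : ℝ) - s)) * ((s : ℝ) - t) ∧
      Var[X s; P] = M.κ₃ / θ ^ 2 * Real.exp (-2 * M.r * ((T : ℝ) - s)) * ((s : ℝ) - t) ∧
      (∫ ω, X s ω ∂P) - θ / 2 * Var[X s; P] = x * Real.exp (M.r * ((s : ℝ) - t))
        + M.κ₃ / θ * Real.exp (-M.r * ((T : ℝ) - s))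
          * (1 - 1 / 2 * Real.exp (-M.r * ((T : ℝ) - s))) * ((s : ℝ) - t)) ∧
    -- dynamic efficient frontier
    ((M.μbar ≠ 0 ∨ M.pbar - M.lam * M.γ₁ ≠ 0) → ∀ s : ℝ≥0, t < s → s ≤ T →
      Var[X s; P] = ((∫ ω, X s ω ∂P) - x * Real.exp (M.r * ((s : ℝ) - t))) ^ 2
        / (M.κ₃ * ((s : ℝ) - t))) := by
  have hexp : ∀ s : ℝ≥0, Real.exp (-2 * M.r * ((T : ℝ) - s))
      = Real.exp (-M.r * ((T : ℝ) - s)) ^ 2 := fun s => by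
    rw [← Real.exp_nat_mul]
    congr 1
    push_cast
    ring
  refine ⟨⟨M.mean_rate_eq_κ₃, M.variance_rate_eq_κ₃, M.κ₃_pos⟩, fun s hts hsT => ?_,
    fun h s hts hsT => ?_⟩
  · obtain ⟨h1, h2, h3⟩ := hX.memLp_and_integral_and_variance M hts hsT
    refine ⟨h1, h2, h3, ?_⟩
    rw [h2, h3, hexp]
    field_simp
    ring
  · obtain ⟨-, h2, h3⟩ := hX.memLp_and_integral_and_variance M hts.le hsT
    -- The squared excess mean is `κ₃ (s-t)` times the variance. As `κ₃ ≠ 0` and `s ≠ t`, this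
    -- factor can be divided out.
    have hκ := (M.κ₃_pos h).ne'
    have hs : (s : ℝ) - t ≠ 0 := sub_ne_zero.2 (by exact_mod_cast hts.ne')
    rw [h2, h3, hexp]
    field_simp
    ring
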